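/- A \emph{knot projection} is a generic immersed closed curve $P$ on the sphere $S^2$ (one component, finitely many transverse double points and no other singularities) with at least one double point. Knot projections are considered up to homeomorphism of $S^2$ and are described by their rotation systems: finite maps on $S^2$ (Euler characteristic $V-E+F=2$) with 4-valent vertices, the double points, and possibly 2-valent vertices, which are merely marked points of the curve, such that the curve running straight through all vertices is a single closed curve. A \emph{circle} below is a simple closed curve on $S^2$ that meets $P$ in double points only and passes at each of them from one corner to the opposite corner. $P$ is \emph{reducible} if some circle meets $P$ in exactly one double point, and \emph{reduced} otherwise. A \emph{Seifert splice} at a double point reconnects the two branches there without crossing and consistently with an orientation of $P$ (the choice of orientation does not matter). Let $i(P)$ be the minimal number of double points of $P$ such that the simultaneous Seifert splices of $P$ at these points yield a reducible knot projection (in particular a single closed curve), with $i(P)=\infty$ if there are none. \textbf{Theorem.} Let $P$ be a reduced knot projection. Then $i(P)=2$ if and only if there is a circle $C$ for which (a) or (b) holds: (a) $C$ meets $P$ in exactly two double points $p,q$; on one side of $C$, an arc of $P$ joins the two ends of $P$ at $p$ to each other and another arc joins the two ends of $P$ at $q$ to each other; on the other side of $C$, two arcs of $P$ each join an end at $p$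 to an end at $q$ (in either of the two possible ways). (b) $C$ meets $P$ in exactly three double points, which can be labelled $p_0,p_1,p_2$ (indices modulo $3$) in a cyclic order along $C$, and $P$ can be oriented, so that at each $p_j$ the two branches of $P$ cross $C$ in opposite directions and, on each of the two sides of $C$, the arc of $P$ that enters that side at $p_j$ leaves it at $p_{j+1}$, for $j=0,1,2$ (at each $p_j$, either of the two branches may be the one that crosses $C$ from left to right). Here an arc of $P$ on one side of $C$ is a part of $P$ between two consecutive passages through $C$; different arcs may cross each other and themselves. -/

import Mathlib

/-!
# Knot projections on the two-sphere

A generic immersed closed curve on the sphere, taken up to orientation-preserving homeomorphism of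
the sphere, is described by its rotation system: the curve is cut into edges by finitely many
points, among them all the double points; a *dart* is an edge together with one of its two ends;
one permutation of the darts goes counterclockwise around the points, another one exchanges the two
ends of each edge.  Double points are 4-valent.  Ordinary points of the curve may be marked as
2-valent vertices; they cut edges into shorter edges and have no other meaning.
The two-sphere is singled out among the closed oriented surfaces by its Euler characteristic.
-/

/-- A closed curve system with transverse double points on a closed oriented surface, with the set
of darts `D`.  Every vertex has valence 4 (a double point) or 2 (an ordinary marked point). -/
structure CurveMap (D : Type*) where
  /-- the next dart, counterclockwise, at the same vertex -/
  rot : Equiv.Perm D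
  /-- the other end of the same edge -/
  edge : Equiv.Perm D
  edge_edge : ∀ d, edge (edge d) = d
  edge_ne : ∀ d, edge d ≠ d
  rot_four : ∀ d, rot (rot (rot (rot d))) = d
  rot_ne : ∀ d, rot d ≠ d

namespace CurveMap

variable {D : Type*}

/-- The number of cycles of a permutation, fixed points included. -/
noncomputable def cycleCount (f : Equiv.Perm D) : ℕ :=
  Nat.card (Quotient (Equiv.Perm.SameCycle.setoid f))

/-- The vertices are the cycles of `rot`. -/
def Vertex (M : CurveMap D) : Type _ := Quotient (Equiv.Perm.SameCycle.setoid M.rot)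

/-- The vertex at which a dart is attached. -/
def vertex (M : CurveMap D) (d : D) : M.Vertex :=
  Quotient.mk (Equiv.Perm.SameCycle.setoid M.rot) d

/-- The dart `d` is attached at a double point (a vertex of valence 4, not 2). -/
def AtDoublePoint (M : CurveMap D) (d : D) : Prop := M.rot (M.rot d) ≠ d

/-- The set of double points of the curve. -/
def doublePoints (M : CurveMap D) : Set M.Vertex :=
  {v | ∃ d, M.vertex d = v ∧ M.AtDoublePoint d}

/-- Walking along the boundary of a region with the region on the left: from the dart `d`, pass to
the other end of its edge and turn left as sharply as possible. -/
def facePerm (M : CurveMap D) : Equiv.Perm D := M.edge.trans M.rot.symm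

/-- The regions (faces), as cycles of `facePerm`. -/
def Face (M : CurveMap D) : Type _ := Quotient (Equiv.Perm.SameCycle.setoid M.facePerm)

/-- The region that contains the corner between the darts `d` and `M.rot d`. -/
def face (M : CurveMap D) (d : D) : M.Face :=
  Quotient.mk (Equiv.Perm.SameCycle.setoid M.facePerm) d

open Classical in
/-- The dart opposite to `d` at the same vertex: the curve that comes in along `d` goes straight
on along `M.opp d`. -/
noncomputable def opp (M : CurveMap D) (d : D) : D :=
  if M.AtDoublePoint d then M.rot (M.rot d) else M.rot d

/-- Walking along the curve: leave a vertex along `d`, arrive at the other end of the edge, go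
straight on. -/
noncomputable def next (M : CurveMap D) (d : D) : D := M.opp (M.edge d)

/-- The curve has just one component: walking along it from any dart runs through all edges
(each in one of its two directions). -/
def OneComponent (M : CurveMap D) : Prop :=
  ∀ d e, ∃ n : ℕ, M.next^[n] d = e ∨ M.next^[n] d = M.edge e

/-- Euler's formula `V - E + F = 2`; for a connected map this says that the surface is the
two-sphere. -/
def Spherical (M : CurveMap D) : Prop :=
  cycleCount M.rot + cycleCount M.facePerm = cycleCount M.edge + 2

/-- A knot projection: one generic closed curve on the two-sphere, with at least one double point. -/
structure IsKnotProjection (M : CurveMap D) : Prop where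
  doublePoints_nonempty : M.doublePoints.Nonempty
  oneComponent : M.OneComponent
  spherical : M.Spherical

/-! ### Circles that meet the curve in double points only -/

/-- An (oriented) simple closed curve on the sphere that meets the curve `M` in exactly `k`
vertices, all of them double points and distinct, and that passes at each of them from one
of the four corners to the opposite one, so that it crosses both branches.  It visits the
points in the cyclic order of `Fin k`; at the `i`-th point it leaves through the corner between
`dart i` and `rot (dart i)`, having come in through the opposite corner.  The part between the
`i`-th and the next point runs inside one region; it runs through pairwise distinct regions. -/
structure Circle (M : CurveMap D) (k : ℕ) [NeZero k] where
  dart : Fin k → D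
  atDoublePoint : ∀ i, M.AtDoublePoint (dart i)
  vertex_injective : Function.Injective fun i => M.vertex (dart i)
  face_eq : ∀ i, M.face (dart i) = M.face (M.rot (M.rot (dart (i + 1))))
  face_injective : Function.Injective fun i => M.face (dart i)

/-- A nugatory crossing exists: some circle meets the curve in just one double point and passes
there between opposite corners. -/
def HasNugatoryCrossing (M : CurveMap D) : Prop := Nonempty (M.Circle 1)

/-- A reducible knot projection. -/
def IsReducibleKnotProjection (M : CurveMap D) : Prop :=
  M.IsKnotProjection ∧ M.HasNugatoryCrossing

/-- A reduced knot projection. -/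
def IsReducedKnotProjection (M : CurveMap D) : Prop :=
  M.IsKnotProjection ∧ ¬ M.HasNugatoryCrossing

/-! ### Seifert splices -/

/-- An orientation of the curve; `out d = true` says that the curve leaves the vertex of `d` along
`d`, `out d = false` that it arrives there along `d`. -/
structure Orientation (M : CurveMap D) where
  out : D → Bool
  out_edge : ∀ d, out (M.edge d) = !out d
  out_opp : ∀ d, out (M.opp d) = !out d

/-- The dart to which a Seifert splice at a double point joins `d`: of the two neighbours of `d`,
the one that the orientation allows (an incoming dart is joined to an outgoing one). -/
def seifertPartner (M : CurveMap D) (O : M.Orientation) (d : D) : D :=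
  if O.out (M.rot d) = O.out d then M.rot.symm d else M.rot d

theorem atDoublePoint_rot (M : CurveMap D) (d : D) :
    M.AtDoublePoint (M.rot d) ↔ M.AtDoublePoint d := by
  simp [AtDoublePoint]

theorem atDoublePoint_rot_symm (M : CurveMap D) (d : D) :
    M.AtDoublePoint (M.rot.symm d) ↔ M.AtDoublePoint d := by
  rw [← atDoublePoint_rot, Equiv.apply_symm_apply]

theorem vertex_rot (M : CurveMap D) (d : D) : M.vertex (M.rot d) = M.vertex d :=
  Quotient.sound (s := Equiv.Perm.SameCycle.setoid M.rot)
    (Equiv.Perm.sameCycle_apply_left.2 (Equiv.Perm.SameCycle.refl _ _))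

theorem vertex_rot_symm (M : CurveMap D) (d : D) : M.vertex (M.rot.symm d) = M.vertex d := by
  rw [← vertex_rot, Equiv.apply_symm_apply]

theorem vertex_mem_doublePoints (M : CurveMap D) (d : D) :
    M.vertex d ∈ M.doublePoints ↔ M.AtDoublePoint d := by
  refine ⟨?_, fun h => ⟨d, rfl, h⟩⟩
  rintro ⟨e, he, h⟩
  have hs : M.rot.SameCycle e d := Quotient.exact (s := Equiv.Perm.SameCycle.setoid M.rot) he
  obtain ⟨n, rfl⟩ := hs
  intro h2
  apply h
  have hc : M.rot (M.rot ((M.rot ^ n) e)) = (M.rot ^ n) (M.rot (M.rot e)) := by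
    simp only [← Equiv.Perm.mul_apply]
    congr 1
    group
  rw [hc] at h2
  exact (M.rot ^ n).injective h2

theorem vertex_seifertPartner (M : CurveMap D) (O : M.Orientation) (d : D) :
    M.vertex (M.seifertPartner O d) = M.vertex d := by
  unfold seifertPartner
  split_ifs
  · exact M.vertex_rot_symm d
  · exact M.vertex_rot d

theorem seifertPartner_ne (M : CurveMap D) (O : M.Orientation) (d : D) :
    M.seifertPartner O d ≠ d := by
  unfold seifertPartner
  split_ifs
  · intro h
    exact M.rot_ne d ((Equiv.symm_apply_eq _).1 h).symm
  · exact M.rot_ne d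

theorem seifertPartner_seifertPartner (M : CurveMap D) (O : M.Orientation) (d : D)
    (hd : M.AtDoublePoint d) : M.seifertPartner O (M.seifertPartner O d) = d := by
  have key : ∀ e, M.AtDoublePoint e → O.out (M.rot (M.rot e)) = !O.out e := by
    intro e he
    have := O.out_opp e
    rwa [opp, if_pos he] at this
  by_cases h : O.out (M.rot d) = O.out d
  · have h1 := key _ ((M.atDoublePoint_rot_symm d).2 hd)
    rw [Equiv.apply_symm_apply, h] at h1
    have h2 : ¬ O.out (M.rot (M.rot.symm d)) = O.out (M.rot.symm d) := by
      rw [Equiv.apply_symm_apply, h1]; simp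
    rw [show M.seifertPartner O d = M.rot.symm d from if_pos h]
    rw [show M.seifertPartner O (M.rot.symm d) = M.rot (M.rot.symm d) from if_neg h2]
    simp
  · have h1 := key d hd
    have h2 : O.out (M.rot (M.rot d)) = O.out (M.rot d) := by
      rw [h1]
      cases h3 : O.out d <;> cases h4 : O.out (M.rot d) <;> simp_all
    rw [show M.seifertPartner O d = M.rot d from if_neg h]
    rw [show M.seifertPartner O (M.rot d) = M.rot.symm (M.rot d) from if_pos h2]
    simp

open Classical in
/-- The rotation after the splices: a spliced double point becomes two 2-valent points. -/
noncomputable def spliceRot (M : CurveMap D) (O : M.Orientation) (S : Set M.Vertex) (d : D) : D :=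
  if M.vertex d ∈ S then M.seifertPartner O d else M.rot d

theorem vertex_spliceRot (M : CurveMap D) (O : M.Orientation) (S : Set M.Vertex) (d : D) :
    M.vertex (M.spliceRot O S d) = M.vertex d := by
  unfold spliceRot
  split_ifs
  · exact M.vertex_seifertPartner O d
  · exact M.vertex_rot d

theorem spliceRot_four (M : CurveMap D) (O : M.Orientation) (S : Set M.Vertex)
    (hS : S ⊆ M.doublePoints) (d : D) :
    M.spliceRot O S (M.spliceRot O S (M.spliceRot O S (M.spliceRot O S d))) = d := by
  by_cases h : M.vertex d ∈ S
  · have h2 : ∀ e, M.vertex e ∈ S → M.spliceRot O S (M.spliceRot O S e) = e := by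
      intro e he
      have he' : M.vertex (M.seifertPartner O e) ∈ S := by rwa [vertex_seifertPartner]
      rw [show M.spliceRot O S e = M.seifertPartner O e from if_pos he]
      rw [show M.spliceRot O S (M.seifertPartner O e) = _ from if_pos he']
      exact M.seifertPartner_seifertPartner O e ((M.vertex_mem_doublePoints e).1 (hS he))
    rw [h2 d h, h2 d h]
  · have h2 : ∀ e, M.vertex e ∉ S → M.spliceRot O S e = M.rot e := fun e he => if_neg he
    rw [h2 d h, h2 (M.rot d) (by rwa [vertex_rot]),
      h2 (M.rot (M.rot d)) (by rwa [vertex_rot, vertex_rot]),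
      h2 (M.rot (M.rot (M.rot d))) (by rwa [vertex_rot, vertex_rot, vertex_rot]), M.rot_four]

/-- The curve obtained by Seifert splices, applied simultaneously at all double points in `S`:
the branches at such a point are reconnected without crossing and consistently with the
orientation. -/
noncomputable def seifertSplice (M : CurveMap D) (O : M.Orientation) (S : Set M.Vertex)
    (hS : S ⊆ M.doublePoints) : CurveMap D where
  rot :=
    { toFun := M.spliceRot O S
      invFun := fun d => M.spliceRot O S (M.spliceRot O S (M.spliceRot O S d))
      left_inv := M.spliceRot_four O S hS
      right_inv := M.spliceRot_four O S hS }
  edge := M.edge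
  edge_edge := M.edge_edge
  edge_ne := M.edge_ne
  rot_four := M.spliceRot_four O S hS
  rot_ne := by
    intro d
    change M.spliceRot O S d ≠ d
    unfold spliceRot
    split_ifs
    · exact M.seifertPartner_ne O d
    · exact M.rot_ne d

/-- The reductivity `i(P)`: the minimal number of Seifert splices that, applied simultaneously,
produce a reducible knot projection (`⊤` if this is impossible). -/
noncomputable def seifertReductivity (P : CurveMap D) : ℕ∞ :=
  sInf {n | ∃ (O : P.Orientation) (S : Set P.Vertex) (hS : S ⊆ P.doublePoints),
    S.encard = n ∧ (P.seifertSplice O S hS).IsReducibleKnotProjection}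

/-! ### The configurations -/

namespace Circle

variable {M : CurveMap D} {k : ℕ} [NeZero k]

/-- The points in which the circle meets the curve. -/
def points (C : M.Circle k) : Set M.Vertex := Set.range fun i => M.vertex (C.dart i)

/-- The four darts at the `i`-th point of the circle.  `left = true` selects the two darts on the
left-hand side of the oriented circle, `left = false` those on its right-hand side; `b` selects
one of the two branches of the curve at that point, and `branchEnd true i b` and `branchEnd false i b`
are the two opposite darts of that branch. -/
def branchEnd (C : M.Circle k) (left : Bool) (i : Fin k) (b : Bool) : D :=
  match left, b with
  | true, false => M.rot (C.dart i)
  | true, true => M.rot (M.rot (C.dart i))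
  | false, false => M.rot (M.rot (M.rot (C.dart i)))
  | false, true => C.dart i

/-- `C.Connects x y`: the arc of the curve that leaves a point of the circle along the dart `x`
meets the circle next at the dart `y`. -/
def Connects (C : M.Circle k) (x y : D) : Prop :=
  ∃ n : ℕ, y = M.edge (M.next^[n] x) ∧ M.vertex y ∈ C.points ∧
    ∀ m < n, M.vertex (M.edge (M.next^[m] x)) ∉ C.points

/-- The configurations with two double points: on one side of the circle, each of the two double
points is joined to itself by an arc of the curve; on the other side, two arcs join the two double
points to each other (in one of the two possible ways, according to `c`). -/
def IsTwoPointConfiguration (C : M.Circle 2) : Prop :=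
  ∃ s c : Bool,
    (∀ i, C.Connects (C.branchEnd s i false) (C.branchEnd s i true)) ∧
    ∀ b, C.Connects (C.branchEnd (!s) 0 b) (C.branchEnd (!s) 1 (xor b c))

/-- The configurations with three double points: at each of them the two branches cross the
circle in opposite directions (the branch `e i` from right to left, the other one from left to
right); on either side of the circle, the curve that comes in at a point goes to the cyclically
next one, where it leaves this side. -/
def IsThreePointConfiguration (C : M.Circle 3) : Prop :=
  ∃ e : Fin 3 → Bool, ∀ i,
    C.Connects (C.branchEnd true i (e i)) (C.branchEnd true (i + 1) (!e (i + 1))) ∧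
    C.Connects (C.branchEnd false i (!e i)) (C.branchEnd false (i + 1) (e (i + 1)))

end Circle

end CurveMap

/-! A Seifert splice multiplies each of three permutations by one transposition: the rotation, the
face permutation and the successor map on outgoing darts. Hence one splice cuts a single closed
curve into two, and a reduced projection needs at least two splices. Suppose two splices leave one
component. Each splits a vertex, and a connected map has V - E + F ≤ 2, so each must merge two
regions: those at the corner between the two outgoing ends and at the corner between the two
incoming ends. The result is again spherical (`spherical_seifertSplice_pair`).

Splices to circle: a crossing is nugatory when two opposite corners lie in one region. If this holds
at `d` only after the splices, a chain of regions through one or both spliced points joins those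
corners (`exists_chain_of_merged`); this is a circle through two or three double points. At the
spliced points the two branches cross it in opposite directions, and they do so at `d` too, because
the curve enters a side as often as it leaves it. The arcs on each side now permute the points of
the circle. With two points, having one component forces one permutation to be the identity and the
other the transposition. With three, the spliced curve has one component as well, and both
permutations are the same 3-cycle.

Circle to splices: in (b), two of the three points are interlaced, so splicing them keeps one
component, and the regions along the circle merge and make the third point nugatory. In (a), the
loop at p crosses the rest of the curve at some x, since otherwise p would be nugatory; p and x are
interlaced, and splicing both makes q nugatory.

That an arc stays on one side of a circle is a discrete Jordan curve theorem
(`Circle.exists_separation`). It and the Euler inequality come from linear algebra: coboundaries of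
vertex functions and boundaries of region functions are orthogonal subspaces of the chains, of
dimensions at least V - 1 and F - 1 in a space of dimension at most E. -/

namespace CurveMap

open Equiv Equiv.Perm Module

/-! ### Cycles of a permutation and of its product with a transposition -/

section Permutations

variable {X : Type*}

/-- The form in which finiteness enters: a forward-stable set is backward-stable, so a walk that
starts in it can only come back to its start from inside it. -/
theorem mem_of_apply_mem [Finite X] {f : Perm X} {T : Set X} (h : ∀ x ∈ T, f x ∈ T) {x : X}
    (hx : f x ∈ T) : x ∈ T := by
  simpa using perm_symm_mapsTo_of_mapsTo f (s := T) h hx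

theorem apply_mem_iff [Finite X] {f : Perm X} {T : Set X} (h : ∀ x ∈ T, f x ∈ T) (x : X) :
    f x ∈ T ↔ x ∈ T :=
  ⟨mem_of_apply_mem h, h x⟩

theorem eq_of_sameCycle {β : Type*} {f : Perm X} {u : X → β} (h : ∀ x, u (f x) = u x) {x y : X}
    (hs : f.SameCycle x y) : u x = u y := by
  obtain ⟨n, rfl⟩ := hs
  have h' : ∀ x, u (f⁻¹ x) = u x := fun x => by
    rw [← h (f⁻¹ x)]
    simp
  induction n using Int.induction_on with
  | zero => simp
  | succ i ih => rw [ih, add_comm, zpow_add, zpow_one, Perm.mul_apply, h]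
  | pred i ih => rw [ih, sub_eq_neg_add, zpow_add, zpow_neg_one, Perm.mul_apply, h']

theorem mem_of_sameCycle [Finite X] {f : Perm X} {T : Set X} (h : ∀ x ∈ T, f x ∈ T) {x y : X}
    (hs : f.SameCycle x y) (hx : x ∈ T) : y ∈ T := by
  have := eq_of_sameCycle (u := fun x => x ∈ T) (fun x => propext (apply_mem_iff h x)) hs
  exact this.mp hx

variable [DecidableEq X]

theorem swap_mul_invariant {β : Type*} {f : Perm X} {u : X → β} (h : ∀ x, u (f x) = u x)
    {a b : X} (hab : u a = u b) (x : X) : u ((swap a b * f) x) = u x := by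
  rw [Perm.mul_apply, swap_apply_def]
  split_ifs with h1 h2
  · rw [← h x, h1, hab]
  · rw [← h x, h2, hab]
  · exact h x

theorem invariant_of_swap_mul {β : Type*} {f : Perm X} {u : X → β} {a b : X}
    (h : ∀ x, u ((swap a b * f) x) = u x) (hab : u a = u b) (x : X) : u (f x) = u x := by
  have := swap_mul_invariant h hab x
  simpa using this

/-- Otherwise the common part of the two cycles of `a` is stable under `f` and never maps onto `a`,
because the point that `f` sends to `a` is sent to `b` by the product. -/
theorem sameCycle_swap_mul [Finite X] {f : Perm X} {a b : X} (h : ¬ f.SameCycle a b) :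
    (swap a b * f).SameCycle a b := by
  by_contra hg
  set g := swap a b * f with hgdef
  have hc : ∀ x ∈ {x | f.SameCycle a x ∧ g.SameCycle a x},
      f x ∈ {x | f.SameCycle a x ∧ g.SameCycle a x} ∧ f x ≠ a := by
    rintro x ⟨h1, h2⟩
    have h3 : f.SameCycle a (f x) := sameCycle_apply_right.2 h1
    have h4 : g.SameCycle a (g x) := sameCycle_apply_right.2 h2
    have hb : f x ≠ b := fun hb => h (hb ▸ h3)
    have ha : f x ≠ a := by
      intro ha
      apply hg
      rwa [hgdef, Perm.mul_apply, ha, swap_apply_left] at h4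
    rw [hgdef, Perm.mul_apply, swap_apply_of_ne_of_ne ha hb] at h4
    exact ⟨⟨h3, h4⟩, ha⟩
  have := mem_of_apply_mem (f := f) (x := f⁻¹ a) (fun x hx => (hc x hx).1)
    (by simpa using ⟨SameCycle.refl f a, SameCycle.refl g a⟩)
  exact (hc _ this).2 (by simp)

theorem sameCycle_swap_mul_of_sameCycle [Finite X] {f : Perm X} {a b : X}
    (h : ¬ f.SameCycle a b) {x y : X} (hxy : f.SameCycle x y) :
    (swap a b * f).SameCycle x y := by
  have hq := eq_of_sameCycle (f := f)
    (u := fun z => Quotient.mk (SameCycle.setoid (swap a b * f)) z)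
    (invariant_of_swap_mul
      (fun z => Quotient.sound (s := SameCycle.setoid (swap a b * f))
        (sameCycle_apply_left.2 (SameCycle.refl _ z)))
      (Quotient.sound (s := SameCycle.setoid (swap a b * f)) (sameCycle_swap_mul h))) hxy
  exact Quotient.exact (s := SameCycle.setoid (swap a b * f)) hq

theorem not_sameCycle_swap_mul [Finite X] {f : Perm X} {a b : X} (h : f.SameCycle a b)
    (hab : a ≠ b) : ¬ (swap a b * f).SameCycle a b := by
  classical
  have hex : ∃ n : ℕ, (f ^ n) a = b := by
    obtain ⟨n, -, hn⟩ := h.exists_pow_eq'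
    exact ⟨n, hn⟩
  set n := Nat.find hex with hn
  have hnb : (f ^ n) a = b := Nat.find_spec hex
  have hmin : ∀ m < n, (f ^ m) a ≠ b := fun m hm => Nat.find_min hex hm
  intro hs
  -- With `n` minimal, the segment `a, f a, ..., f ^ (n - 1) a` closes up: the step that led to `b`
  -- now leads to `a`.
  have hT : ∀ x ∈ {x | ∃ i < n, (f ^ i) a = x}, (swap a b * f) x ∈ {x | ∃ i < n, (f ^ i) a = x} := by
    rintro _ ⟨i, hi, rfl⟩
    rw [Perm.mul_apply, ← Perm.mul_apply f, ← pow_succ']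
    rcases eq_or_lt_of_le (Nat.succ_le_of_lt hi) with h1 | h1
    · rw [show i + 1 = n from h1, hnb, swap_apply_right]
      exact ⟨0, by omega, by simp⟩
    · have ha : (f ^ (i + 1)) a ≠ a := by
        intro ha
        apply hmin (n - (i + 1)) (by omega)
        conv_lhs => rw [← ha]
        rw [← Perm.mul_apply, ← pow_add, Nat.sub_add_cancel (by omega), hnb]
      rw [swap_apply_of_ne_of_ne ha (hmin _ h1)]
      exact ⟨i + 1, h1, rfl⟩
  have hpos : 0 < n := by
    rcases Nat.eq_zero_or_pos n with h0 | h0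
    · rw [h0] at hnb
      exact absurd hnb (by simpa using hab)
    · exact h0
  obtain ⟨i, hi, hib⟩ := mem_of_sameCycle hT hs ⟨0, hpos, by simp⟩
  exact hmin i hi hib


end Permutations

/-! ### Number of cycles as the dimension of the space of invariant functions -/

section CycleCount

variable {X : Type*}

/-- The real functions that are constant on the cycles of `f`. -/
def invariants (f : Perm X) : Submodule ℝ (X → ℝ) where
  carrier := {u | ∀ x, u (f x) = u x}
  add_mem' := fun hu hv x => by simp [hu x, hv x]
  zero_mem' := fun x => rfl
  smul_mem' := fun c u hu x => by simp [hu x]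

theorem finrank_invariants [Finite X] (f : Perm X) :
    finrank ℝ (invariants f) = cycleCount f := by
  have e : (Quotient (SameCycle.setoid f) → ℝ) ≃ₗ[ℝ] invariants f :=
    { toFun := fun u => ⟨fun x => u (Quotient.mk _ x), fun x => congrArg u
        (Quotient.sound (s := SameCycle.setoid f) (sameCycle_apply_left.2 (SameCycle.refl _ x)))⟩
      map_add' := fun u v => rfl
      map_smul' := fun c u => rfl
      invFun := fun u q => Quotient.lift u.1 (fun x y hxy => eq_of_sameCycle u.2 hxy) q
      left_inv := fun u => by
        funext q
        induction q using Quotient.inductionOn with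
        | h x => rfl
      right_inv := fun u => rfl }
  have := Fintype.ofFinite (Quotient (SameCycle.setoid f))
  rw [← e.finrank_eq, finrank_fintype_fun_eq_card, cycleCount, Nat.card_eq_fintype_card]

variable [DecidableEq X]

/-- The single linear condition `u a = u b` makes an `f`-invariant function invariant under the
product. -/
theorem cycleCount_le_swap_mul [Finite X] (f : Perm X) (a b : X) :
    cycleCount f ≤ cycleCount (swap a b * f) + 1 := by
  set g := swap a b * f with hg
  let L : invariants f →ₗ[ℝ] ℝ :=
    (LinearMap.proj a - LinearMap.proj (R := ℝ) (φ := fun _ : X => ℝ) b) ∘ₗ (invariants f).subtype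
  have h1 := L.finrank_range_add_finrank_ker
  have h2 : finrank ℝ (LinearMap.range L) ≤ 1 := by
    simpa using Submodule.finrank_le (LinearMap.range L)
  have h3 : finrank ℝ (LinearMap.ker L) ≤ finrank ℝ (invariants g) := by
    let J : LinearMap.ker L →ₗ[ℝ] invariants g :=
      ((invariants f).subtype ∘ₗ (LinearMap.ker L).subtype).codRestrict _ (by
        rintro ⟨⟨u, hu⟩, hL⟩
        refine swap_mul_invariant hu ?_
        simpa [L, sub_eq_zero] using hL)
    refine LinearMap.finrank_le_finrank_of_injective (f := J) ?_
    intro u v huv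
    have := congrArg Subtype.val huv
    exact Subtype.ext (Subtype.ext this)
  rw [finrank_invariants] at h1 h3
  omega

/-- All `f`-invariant functions remain invariant, and the indicator of the new cycle of `a`, which
misses `b`, is an additional one. -/
theorem cycleCount_lt_swap_mul [Finite X] {f : Perm X} {a b : X} (h : f.SameCycle a b)
    (hab : a ≠ b) : cycleCount f < cycleCount (swap a b * f) := by
  rw [← finrank_invariants, ← finrank_invariants]
  apply Submodule.finrank_lt_finrank_of_lt
  refine lt_of_le_of_ne (fun u hu => swap_mul_invariant hu (eq_of_sameCycle hu h)) ?_
  intro heq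
  classical
  have hn := not_sameCycle_swap_mul h hab
  let u : X → ℝ := fun x => if (swap a b * f).SameCycle a x then 1 else 0
  have hu : u ∈ invariants (swap a b * f) := fun x => by
    simp only [u, sameCycle_apply_right]
  rw [← heq] at hu
  have := eq_of_sameCycle hu h
  simp [u, hn, SameCycle.refl] at this

end CycleCount

/-! ### Orthogonal decomposition of the chains and the Euler inequality -/

section Homology

variable {D : Type*} (M : CurveMap D)

/-- Every function on the darts that is constant at each vertex and on each edge is constant. -/
def IsConnected : Prop :=
  ∀ u : D → ℝ, (∀ x, u (M.rot x) = u x) → (∀ x, u (M.edge x) = u x) → ∀ x y, u x = u y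

/-- The chains: functions on the darts that change sign under `edge`. -/
def chains : Submodule ℝ (D → ℝ) where
  carrier := {c | ∀ d, c (M.edge d) = - c d}
  add_mem' := fun hu hv x => by simp [hu x, hv x, add_comm]
  zero_mem' := fun x => by simp
  smul_mem' := fun c u hu x => by simp [hu x]

theorem rot_facePerm (d : D) : M.rot (M.facePerm d) = M.edge d := by
  simp [facePerm]

/-- The difference `u ∘ edge - u`. -/
def diff : (D → ℝ) →ₗ[ℝ] (D → ℝ) where
  toFun u d := u (M.edge d) - u d
  map_add' u v := by funext d; simp; ring
  map_smul' c u := by funext d; simp; ring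

theorem diff_mem_chains (u : D → ℝ) : M.diff u ∈ M.chains := fun d => by
  simp [diff, M.edge_edge]

theorem sum_edge [Fintype D] (u : D → ℝ) : ∑ d, u (M.edge d) = ∑ d, u d :=
  Equiv.sum_comp M.edge u

theorem sum_chain_mul_diff [Fintype D] {c : D → ℝ} (hc : c ∈ M.chains) (u : D → ℝ) :
    ∑ d, c d * M.diff u d = - 2 * ∑ d, c d * u d := by
  have h := M.sum_edge (fun d => c d * u (M.edge d))
  simp only [M.edge_edge, hc _] at h
  simp only [diff, LinearMap.coe_mk, AddHom.coe_mk, mul_sub, Finset.sum_sub_distrib, ← h]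
  simp only [neg_mul, Finset.sum_neg_distrib]
  ring

/-- The boundary of a region is a closed walk, along which a coboundary sums to zero. -/
theorem sum_diff_mul_diff [Fintype D] {g k : D → ℝ} (hg : g ∈ invariants M.rot)
    (hk : k ∈ invariants M.facePerm) : ∑ d, M.diff g d * M.diff k d = 0 := by
  rw [M.sum_chain_mul_diff (M.diff_mem_chains g)]
  have h := Equiv.sum_comp M.facePerm (fun d => g d * k d)
  have h2 : ∀ d, g (M.facePerm d) = g (M.edge d) := fun d => by
    rw [← M.rot_facePerm, hg]
  simp only [h2, hk _] at h
  simp [diff, sub_mul, Finset.sum_sub_distrib, h]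

/-- The coboundaries of the functions on the vertices. -/
def vertexChains : Submodule ℝ (D → ℝ) := (invariants M.rot).map M.diff

/-- The boundaries of the functions on the regions. -/
def faceChains : Submodule ℝ (D → ℝ) := (invariants M.facePerm).map M.diff

variable {M}

theorem IsConnected.of_facePerm (h : M.IsConnected) {u : D → ℝ} (h1 : ∀ x, u (M.facePerm x) = u x)
    (h2 : ∀ x, u (M.edge x) = u x) (x y : D) : u x = u y := by
  refine h u (fun x => ?_) h2 x y
  have h3 := h1 (M.edge (M.rot x))
  rw [h2] at h3
  rw [← h3]
  simp [facePerm, M.edge_edge]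

/-- The kernel of `diff` on `W` consists of constants. -/
theorem finrank_le_finrank_map_diff [Finite D] {W : Submodule ℝ (D → ℝ)}
    (h : ∀ u ∈ W, (∀ x, u (M.edge x) = u x) → ∀ x y, u x = u y) :
    finrank ℝ W ≤ finrank ℝ (W.map M.diff) + 1 := by
  have h1 := (M.diff.domRestrict W).finrank_range_add_finrank_ker
  rw [LinearMap.range_domRestrict] at h1
  have h2 : finrank ℝ (LinearMap.ker (M.diff.domRestrict W)) ≤ 1 := by
    let J : LinearMap.ker (M.diff.domRestrict W) →ₗ[ℝ] Submodule.span ℝ {(fun _ => 1 : D → ℝ)} :=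
      (W.subtype ∘ₗ (LinearMap.ker (M.diff.domRestrict W)).subtype).codRestrict _ (by
        rintro ⟨⟨u, hu⟩, hL⟩
        rw [Submodule.mem_span_singleton]
        have hc := h u hu (fun x => by
          have := congrFun (show M.diff u = 0 from hL) x
          exact sub_eq_zero.1 this)
        rcases isEmpty_or_nonempty D with hD | ⟨⟨d⟩⟩
        · exact ⟨0, Subsingleton.elim _ _⟩
        · exact ⟨u d, by funext x; simp [hc x d]⟩)
    refine (LinearMap.finrank_le_finrank_of_injective (f := J) ?_).trans
      ((finrank_span_le_card _).trans (by simp))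
    intro u v huv
    have := congrArg Subtype.val huv
    exact Subtype.ext (Subtype.ext this)
  omega

theorem disjoint_vertexChains_faceChains [Finite D] : Disjoint M.vertexChains M.faceChains := by
  have := Fintype.ofFinite D
  rw [Submodule.disjoint_def]
  rintro c ⟨g, hg, rfl⟩ ⟨k, hk, hgk⟩
  have h := M.sum_diff_mul_diff hg hk
  rw [hgk] at h
  funext d
  have := (Finset.sum_eq_zero_iff_of_nonneg (fun d _ => mul_self_nonneg _)).1 h d (Finset.mem_univ d)
  simpa using this

/-- Multiplication by a nowhere vanishing chain turns chains into functions on the edges. An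
orientation will supply such a chain. -/
theorem finrank_chains_le [Finite D] {ε : D → ℝ} (hε : ε ∈ M.chains) (h0 : ∀ d, ε d ≠ 0) :
    finrank ℝ M.chains ≤ cycleCount M.edge := by
  rw [← finrank_invariants]
  let J : M.chains →ₗ[ℝ] invariants M.edge :=
    ((LinearMap.mulLeft ℝ ε) ∘ₗ M.chains.subtype).codRestrict _ (by
      rintro ⟨c, hc⟩ d
      simp [hc d, hε d])
  refine LinearMap.finrank_le_finrank_of_injective (f := J) ?_
  intro u v huv
  have := congrArg Subtype.val huv
  refine Subtype.ext (funext fun d => ?_)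
  exact mul_left_cancel₀ (h0 d) (congrFun this d)

theorem vertexChains_sup_faceChains_le : M.vertexChains ⊔ M.faceChains ≤ M.chains := by
  refine sup_le ?_ ?_ <;> rintro _ ⟨g, -, rfl⟩ <;> exact M.diff_mem_chains g

theorem IsConnected.le_finrank_sup [Finite D] (h : M.IsConnected) :
    cycleCount M.rot + cycleCount M.facePerm ≤
      finrank ℝ (M.vertexChains ⊔ M.faceChains : Submodule ℝ (D → ℝ)) + 2 := by
  have h1 := Submodule.finrank_sup_add_finrank_inf_eq M.vertexChains M.faceChains
  rw [disjoint_vertexChains_faceChains.eq_bot, finrank_bot] at h1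
  have h2 : finrank ℝ (invariants M.rot) ≤ finrank ℝ M.vertexChains + 1 :=
    finrank_le_finrank_map_diff fun u hu => h u hu
  have h3 : finrank ℝ (invariants M.facePerm) ≤ finrank ℝ M.faceChains + 1 :=
    finrank_le_finrank_map_diff fun u hu => h.of_facePerm hu
  rw [finrank_invariants] at h2 h3
  omega

theorem IsConnected.euler_le [Finite D] (h : M.IsConnected) {ε : D → ℝ} (hε : ε ∈ M.chains)
    (h0 : ∀ d, ε d ≠ 0) :
    cycleCount M.rot + cycleCount M.facePerm ≤ cycleCount M.edge + 2 := by
  have h1 := h.le_finrank_sup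
  have h2 := Submodule.finrank_mono (M.vertexChains_sup_faceChains_le)
  have h3 := finrank_chains_le hε h0
  omega

/-- On the sphere, a chain that is orthogonal to the boundaries of all regions is the coboundary of a
function on the vertices. -/
theorem Spherical.exists_diff_eq [Fintype D] (hs : M.Spherical) (h : M.IsConnected) {ε : D → ℝ}
    (hε : ε ∈ M.chains) (h0 : ∀ d, ε d ≠ 0) {c : D → ℝ} (hc : c ∈ M.chains)
    (horth : ∀ k ∈ invariants M.facePerm, ∑ d, c d * k d = 0) :
    ∃ g ∈ invariants M.rot, M.diff g = c := by
  have h1 := h.le_finrank_sup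
  have h3 := finrank_chains_le hε h0
  have h4 := Submodule.eq_of_le_of_finrank_le (M.vertexChains_sup_faceChains_le)
    (by rw [Spherical] at hs; omega)
  rw [← h4, Submodule.mem_sup] at hc
  obtain ⟨_, ⟨g, hg, rfl⟩, _, ⟨k, hk, rfl⟩, hgk⟩ := hc
  have hc' : c ∈ M.chains := hgk ▸ M.chains.add_mem (M.diff_mem_chains g) (M.diff_mem_chains k)
  have h5 := M.sum_chain_mul_diff hc' k
  -- The chain is orthogonal to its own component `diff k`, and so is `diff g`; hence `diff k` has
  -- norm zero.
  rw [horth k hk, mul_zero, ← hgk] at h5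
  simp only [Pi.add_apply, add_mul, Finset.sum_add_distrib, M.sum_diff_mul_diff hg hk,
    zero_add] at h5
  refine ⟨g, hg, ?_⟩
  rw [← hgk]
  funext d
  have := (Finset.sum_eq_zero_iff_of_nonneg (fun d _ => mul_self_nonneg _)).1 h5 d
    (Finset.mem_univ d)
  simpa using this

end Homology

/-! ### Walking along the curve -/

section Basic

variable {D : Type*} (M : CurveMap D)

theorem rot_rot_rot (d : D) : M.rot (M.rot (M.rot d)) = M.rot.symm d := by
  rw [Equiv.eq_symm_apply, M.rot_four]

theorem rot_rot_rot_ne (d : D) : M.rot (M.rot (M.rot d)) ≠ d := by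
  intro h
  have := M.rot_four d
  rw [h] at this
  exact M.rot_ne d this

theorem opp_of_atDoublePoint {d : D} (h : M.AtDoublePoint d) : M.opp d = M.rot (M.rot d) :=
  if_pos h

theorem opp_of_not_atDoublePoint {d : D} (h : ¬ M.AtDoublePoint d) : M.opp d = M.rot d :=
  if_neg h

theorem vertex_opp (d : D) : M.vertex (M.opp d) = M.vertex d := by
  by_cases h : M.AtDoublePoint d
  · rw [M.opp_of_atDoublePoint h, vertex_rot, vertex_rot]
  · rw [M.opp_of_not_atDoublePoint h, vertex_rot]

theorem atDoublePoint_congr {x y : D} (h : M.vertex x = M.vertex y) :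
    M.AtDoublePoint x ↔ M.AtDoublePoint y := by
  rw [← vertex_mem_doublePoints, h, vertex_mem_doublePoints]

theorem opp_opp (d : D) : M.opp (M.opp d) = d := by
  by_cases h : M.AtDoublePoint d
  · have h2 : M.AtDoublePoint (M.opp d) := (M.atDoublePoint_congr (M.vertex_opp d)).2 h
    rw [M.opp_of_atDoublePoint h2, M.opp_of_atDoublePoint h, M.rot_four]
  · have h2 : ¬ M.AtDoublePoint (M.opp d) := (M.atDoublePoint_congr (M.vertex_opp d)).not.2 h
    rw [M.opp_of_not_atDoublePoint h2, M.opp_of_not_atDoublePoint h]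
    exact not_not.1 h

theorem opp_ne (d : D) : M.opp d ≠ d := by
  by_cases h : M.AtDoublePoint d
  · rwa [M.opp_of_atDoublePoint h]
  · rw [M.opp_of_not_atDoublePoint h]
    exact M.rot_ne d

theorem vertex_eq_iff [Finite D] {x y : D} : M.vertex x = M.vertex y ↔
    y = x ∨ y = M.rot x ∨ y = M.rot (M.rot x) ∨ y = M.rot (M.rot (M.rot x)) := by
  constructor
  · intro h
    have hs : M.rot.SameCycle x y := Quotient.exact (s := SameCycle.setoid M.rot) h
    refine mem_of_sameCycle
      (T := {y | y = x ∨ y = M.rot x ∨ y = M.rot (M.rot x) ∨ y = M.rot (M.rot (M.rot x))})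
      ?_ hs (Or.inl rfl)
    rintro _ (rfl | rfl | rfl | rfl) <;> simp [M.rot_four]
  · rintro (rfl | rfl | rfl | rfl) <;> simp [vertex_rot]

theorem next_edge_next (d : D) : M.next (M.edge (M.next d)) = M.edge d := by
  simp [next, M.edge_edge, opp_opp]

theorem next_iterate_edge (n : ℕ) (d : D) :
    M.next^[n] (M.edge (M.next^[n] d)) = M.edge d := by
  induction n with
  | zero => rfl
  | succ n ih => rw [Function.iterate_succ_apply, Function.iterate_succ_apply', next_edge_next, ih]

theorem vertex_next (d : D) : M.vertex (M.next d) = M.vertex (M.edge d) := M.vertex_opp _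

/-- One step along the curve, as a permutation of the darts. -/
noncomputable def nextPerm : Perm D where
  toFun := M.next
  invFun d := M.edge (M.opp d)
  left_inv d := by simp [next, opp_opp, M.edge_edge]
  right_inv d := by simp [next, opp_opp, M.edge_edge]

theorem nextPerm_apply (d : D) : M.nextPerm d = M.next d := rfl

theorem next_injective : Function.Injective M.next := M.nextPerm.injective

theorem OneComponent.isConnected {M : CurveMap D} (h : M.OneComponent) : M.IsConnected := by
  intro u h1 h2 x y
  have h3 : ∀ x, u (M.opp x) = u x := fun x => by
    by_cases hx : M.AtDoublePoint x
    · rw [M.opp_of_atDoublePoint hx, h1, h1]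
    · rw [M.opp_of_not_atDoublePoint hx, h1]
  have h4 : ∀ n x, u (M.next^[n] x) = u x := fun n x => by
    induction n with
    | zero => rfl
    | succ n ih => rw [Function.iterate_succ_apply', next, h3, h2, ih]
  obtain ⟨n, hn | hn⟩ := h x y
  · rw [← hn, h4]
  · rw [← h2 y, ← hn, h4]

/-- A walk that came back along its own edge would be its own reversal; at its midpoint `edge` or
`opp` would have a fixed point. This is what makes the curve orientable. -/
theorem next_iterate_ne_edge (n : ℕ) (d : D) : M.next^[n] d ≠ M.edge d := by
  intro h
  have hinj : ∀ m, Function.Injective M.next^[m] := fun m => M.next_injective.iterate m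
  obtain ⟨m, rfl | rfl⟩ := Nat.even_or_odd' n
  · rw [two_mul, Function.iterate_add_apply, ← M.next_iterate_edge m d] at h
    exact M.edge_ne _ (hinj m h).symm
  · rw [show 2 * m + 1 = m + (m + 1) by omega, Function.iterate_add_apply,
      ← M.next_iterate_edge m d] at h
    have h2 := hinj m h
    rw [Function.iterate_succ_apply'] at h2
    exact M.opp_ne _ h2

end Basic

/-! ### Orientations and the successor map on outgoing darts -/

namespace Orientation

variable {D : Type*} {M : CurveMap D} (O : M.Orientation)

theorem out_next (d : D) : O.out (M.next d) = O.out d := by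
  rw [next, O.out_opp, O.out_edge, Bool.not_not]

theorem out_next_iterate (n : ℕ) (d : D) : O.out (M.next^[n] d) = O.out d := by
  induction n with
  | zero => rfl
  | succ n ih => rw [Function.iterate_succ_apply', out_next, ih]

theorem out_rot_rot {d : D} (h : M.AtDoublePoint d) : O.out (M.rot (M.rot d)) = !O.out d := by
  rw [← M.opp_of_atDoublePoint h, O.out_opp]

theorem out_rot_rot_rot {d : D} (h : M.AtDoublePoint d) :
    O.out (M.rot (M.rot (M.rot d))) = !O.out (M.rot d) :=
  O.out_rot_rot ((M.atDoublePoint_rot d).2 h)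

/-- The sign of a dart: `1` if the curve leaves along it and `-1` if it arrives. -/
noncomputable def sign (d : D) : ℝ := if O.out d then 1 else -1

theorem sign_mem_chains : O.sign ∈ M.chains := fun d => by
  simp only [sign, O.out_edge]
  cases O.out d <;> simp

theorem sign_ne_zero (d : D) : O.sign d ≠ 0 := by
  unfold sign
  split_ifs <;> norm_num

theorem sign_opp (d : D) : O.sign (M.opp d) = - O.sign d := by
  simp only [sign, O.out_opp]
  cases O.out d <;> simp

/-- One step along the curve, as a permutation of the outgoing darts. -/
noncomputable def outNext : Perm {d // O.out d = true} :=
  M.nextPerm.subtypePerm fun d => by rw [nextPerm_apply, O.out_next]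

theorem coe_outNext (x : {d // O.out d = true}) : (O.outNext x : D) = M.next x := rfl

theorem coe_outNext_pow (n : ℕ) (x : {d // O.out d = true}) :
    ((O.outNext ^ n) x : D) = M.next^[n] x := by
  induction n with
  | zero => rfl
  | succ n ih => rw [pow_succ', Perm.mul_apply, coe_outNext, ih, Function.iterate_succ_apply']

theorem oneComponent_iff [Finite D] :
    M.OneComponent ↔ ∀ x y, O.outNext.SameCycle x y := by
  constructor
  · intro h x y
    obtain ⟨n, hn | hn⟩ := h x y
    · exact ⟨n, Subtype.ext (by rw [zpow_natCast, coe_outNext_pow, hn])⟩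
    · have := O.out_next_iterate n x
      rw [hn, O.out_edge, x.2, y.2] at this
      simp at this
  · intro h
    have key : ∀ d e, O.out d = true → O.out e = true → ∃ n : ℕ, M.next^[n] d = e := by
      intro d e hd he
      obtain ⟨n, -, hn⟩ := (h ⟨d, hd⟩ ⟨e, he⟩).exists_pow_eq'
      exact ⟨n, by rw [← coe_outNext_pow O n ⟨d, hd⟩, hn]⟩
    have key2 : ∀ d e, O.out d = true → ∃ n : ℕ, M.next^[n] d = e ∨ M.next^[n] d = M.edge e := by
      intro d e hd
      cases he : O.out e
      · obtain ⟨n, hn⟩ := key d (M.edge e) hd (by simp [O.out_edge, he])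
        exact ⟨n, Or.inr hn⟩
      · obtain ⟨n, hn⟩ := key d e hd he
        exact ⟨n, Or.inl hn⟩
    intro d e
    cases hd : O.out d
    · obtain ⟨e', he', hee⟩ : ∃ e', O.out e' = true ∧ (e' = e ∨ e' = M.edge e) := by
        cases he : O.out e
        · exact ⟨_, by simp [O.out_edge, he], Or.inr rfl⟩
        · exact ⟨_, he, Or.inl rfl⟩
      obtain ⟨n, hn⟩ := key e' (M.edge d) he' (by simp [O.out_edge, hd])
      have h2 := M.next_iterate_edge n e'
      rw [hn, M.edge_edge] at h2
      refine ⟨n, ?_⟩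
      rcases hee with rfl | rfl
      · exact Or.inr h2
      · exact Or.inl (by rw [h2, M.edge_edge])
    · exact key2 d e hd

end Orientation

theorem OneComponent.exists_orientation {D : Type*} [Finite D] {M : CurveMap D}
    (h : M.OneComponent) (d₀ : D) : ∃ O : M.Orientation, O.out d₀ = true := by
  classical
  have hper : ∀ x, ∃ n, M.next^[n] (M.next x) = x := fun x => by
    obtain ⟨n, -, hn⟩ := (sameCycle_apply_left.2 (SameCycle.refl M.nextPerm x)).exists_pow_eq'
    rw [← Perm.iterate_eq_pow] at hn
    exact ⟨n, hn⟩
  -- The outgoing darts are those on the forward walk from `d₀`; `edge` exchanges this set with its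
  -- complement.
  set T : Set D := {x | ∃ n, M.next^[n] d₀ = x} with hT
  have hnext : ∀ x, M.next x ∈ T ↔ x ∈ T := fun x => by
    refine ⟨?_, ?_⟩
    · rintro ⟨n, hn⟩
      obtain ⟨m, hm⟩ := hper x
      exact ⟨m + n, by rw [Function.iterate_add_apply, hn, hm]⟩
    · rintro ⟨n, rfl⟩
      exact ⟨n + 1, Function.iterate_succ_apply' ..⟩
  have hedge : ∀ x, M.edge x ∈ T ↔ ¬ x ∈ T := fun x => by
    constructor
    · rintro ⟨n, hn⟩ ⟨m, hm⟩
      have h2 := M.next_iterate_edge n d₀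
      rw [hn, M.edge_edge, ← hm, ← Function.iterate_add_apply] at h2
      exact M.next_iterate_ne_edge _ _ h2
    · intro hx
      obtain ⟨n, hn | hn⟩ := h d₀ x
      · exact absurd ⟨n, hn⟩ hx
      · exact ⟨n, hn⟩
  refine ⟨⟨fun d => decide (d ∈ T), fun d => ?_, fun d => ?_⟩, ?_⟩
  · simp [hedge]
  · have h1 := hnext (M.edge d)
    rw [next, M.edge_edge, hedge] at h1
    simp [h1]
  · simpa using ⟨0, rfl⟩

/-! ### A splice as multiplication by transpositions -/

section Splice

variable {D : Type*} {M : CurveMap D} (O : M.Orientation)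

theorem seifertPartner_of_eq {d : D} (h : O.out (M.rot d) = O.out d) :
    M.seifertPartner O d = M.rot.symm d := if_pos h

theorem seifertPartner_of_ne {d : D} (h : O.out (M.rot d) ≠ O.out d) :
    M.seifertPartner O d = M.rot d := if_neg h

theorem out_seifertPartner {d : D} (hd : M.AtDoublePoint d) :
    O.out (M.seifertPartner O d) = !O.out d := by
  by_cases h : O.out (M.rot d) = O.out d
  · rw [seifertPartner_of_eq O h, ← rot_rot_rot, O.out_rot_rot_rot hd, h]
  · rw [seifertPartner_of_ne O h]
    cases h1 : O.out d <;> cases h2 : O.out (M.rot d) <;> simp_all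

theorem seifertPartner_ne_opp {d : D} (hd : M.AtDoublePoint d) :
    M.seifertPartner O d ≠ M.opp d := by
  rw [M.opp_of_atDoublePoint hd]
  by_cases h : O.out (M.rot d) = O.out d
  · rw [seifertPartner_of_eq O h, ← rot_rot_rot]
    exact M.rot_ne _
  · rw [seifertPartner_of_ne O h]
    exact fun h => M.rot_ne d (M.rot.injective h).symm

theorem seifertSplice_rot_of_mem {S : Set M.Vertex} (hS : S ⊆ M.doublePoints) {d : D}
    (h : M.vertex d ∈ S) : (M.seifertSplice O S hS).rot d = M.seifertPartner O d := if_pos h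

theorem seifertSplice_rot_of_notMem {S : Set M.Vertex} (hS : S ⊆ M.doublePoints) {d : D}
    (h : M.vertex d ∉ S) : (M.seifertSplice O S hS).rot d = M.rot d := if_neg h

theorem seifertSplice_rot_rot_of_notMem {S : Set M.Vertex} (hS : S ⊆ M.doublePoints) {d : D}
    (h : M.vertex d ∉ S) :
    (M.seifertSplice O S hS).rot ((M.seifertSplice O S hS).rot d) = M.rot (M.rot d) := by
  rw [seifertSplice_rot_of_notMem O hS h, seifertSplice_rot_of_notMem O hS (by rwa [vertex_rot])]

theorem seifertSplice_edge {S : Set M.Vertex} (hS : S ⊆ M.doublePoints) :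
    (M.seifertSplice O S hS).edge = M.edge := rfl

theorem seifertSplice_rot_rot_of_mem {S : Set M.Vertex} (hS : S ⊆ M.doublePoints) {d : D}
    (h : M.vertex d ∈ S) :
    (M.seifertSplice O S hS).rot ((M.seifertSplice O S hS).rot d) = d := by
  rw [seifertSplice_rot_of_mem O hS h,
    seifertSplice_rot_of_mem O hS (by rwa [vertex_seifertPartner]),
    seifertPartner_seifertPartner]
  exact (M.vertex_mem_doublePoints d).1 (hS h)

theorem seifertSplice_atDoublePoint {S : Set M.Vertex} (hS : S ⊆ M.doublePoints) (d : D) :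
    (M.seifertSplice O S hS).AtDoublePoint d ↔ M.AtDoublePoint d ∧ M.vertex d ∉ S := by
  by_cases h : M.vertex d ∈ S
  · simp [AtDoublePoint, h, seifertSplice_rot_rot_of_mem O hS h]
  · simp [AtDoublePoint, h, seifertSplice_rot_rot_of_notMem O hS h]

theorem seifertSplice_opp_of_mem {S : Set M.Vertex} (hS : S ⊆ M.doublePoints) {d : D}
    (h : M.vertex d ∈ S) : (M.seifertSplice O S hS).opp d = M.seifertPartner O d := by
  rw [opp_of_not_atDoublePoint, seifertSplice_rot_of_mem O hS h]
  simp [seifertSplice_atDoublePoint, h]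

theorem seifertSplice_opp_of_notMem {S : Set M.Vertex} (hS : S ⊆ M.doublePoints) {d : D}
    (h : M.vertex d ∉ S) : (M.seifertSplice O S hS).opp d = M.opp d := by
  by_cases hd : M.AtDoublePoint d
  · rw [opp_of_atDoublePoint, seifertSplice_rot_rot_of_notMem O hS h, opp_of_atDoublePoint _ hd]
    simp [seifertSplice_atDoublePoint, h, hd]
  · rw [opp_of_not_atDoublePoint, seifertSplice_rot_of_notMem O hS h,
      opp_of_not_atDoublePoint _ hd]
    simp [seifertSplice_atDoublePoint, hd]

/-- The orientation of the curve is an orientation of the spliced curve as well. -/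
@[reducible] def Orientation.splice {S : Set M.Vertex} (hS : S ⊆ M.doublePoints) :
    (M.seifertSplice O S hS).Orientation where
  out := O.out
  out_edge := O.out_edge
  out_opp d := by
    by_cases h : M.vertex d ∈ S
    · rw [seifertSplice_opp_of_mem O hS h,
        out_seifertPartner O ((M.vertex_mem_doublePoints d).1 (hS h))]
    · rw [seifertSplice_opp_of_notMem O hS h, O.out_opp]

theorem seifertSplice_next_of_mem {S : Set M.Vertex} (hS : S ⊆ M.doublePoints) {d : D}
    (h : M.vertex (M.edge d) ∈ S) :
    (M.seifertSplice O S hS).next d = M.seifertPartner O (M.edge d) :=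
  seifertSplice_opp_of_mem O hS h

theorem seifertSplice_next_of_notMem {S : Set M.Vertex} (hS : S ⊆ M.doublePoints) {d : D}
    (h : M.vertex (M.edge d) ∉ S) : (M.seifertSplice O S hS).next d = M.next d :=
  seifertSplice_opp_of_notMem O hS h

theorem seifertSplice_empty (h : ∅ ⊆ M.doublePoints) : M.seifertSplice O ∅ h = M := by
  have h1 : (M.seifertSplice O ∅ h).rot = M.rot := by
    ext d
    exact seifertSplice_rot_of_notMem O h (Set.notMem_empty _)
  cases M
  simp only [seifertSplice, mk.injEq, and_true] at h1 ⊢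
  exact h1

theorem rot_ne_rot_rot_rot {d : D} (hd : M.AtDoublePoint d) :
    M.rot d ≠ M.rot (M.rot (M.rot d)) := fun h => hd (M.rot.injective h).symm

theorem seifertPartner_of_coherent {d : D} (hd : M.AtDoublePoint d)
    (hco : O.out (M.rot d) = O.out d) :
    M.seifertPartner O d = M.rot (M.rot (M.rot d)) ∧
    M.seifertPartner O (M.rot d) = M.rot (M.rot d) ∧
    M.seifertPartner O (M.rot (M.rot d)) = M.rot d ∧
    M.seifertPartner O (M.rot (M.rot (M.rot d))) = d := by
  have h2 := O.out_rot_rot hd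
  have h3 := O.out_rot_rot_rot hd
  refine ⟨?_, ?_, ?_, ?_⟩
  · rw [seifertPartner_of_eq O hco, rot_rot_rot]
  · rw [seifertPartner_of_ne O]
    simp [h2, hco]
  · rw [seifertPartner_of_eq O, symm_apply_apply]
    simp [h2, h3, hco]
  · rw [seifertPartner_of_ne O, M.rot_four]
    simp [M.rot_four, h3, hco]

theorem eq_or_eq_or_eq_of_vertex_eq [Finite D] {x y z : D} (hx : M.AtDoublePoint x)
    (hy : M.vertex x = M.vertex y) (hz : M.vertex x = M.vertex z) (oy : O.out x = O.out y)
    (oz : O.out x = O.out z) : x = y ∨ x = z ∨ y = z := by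
  have h2 := O.out_rot_rot hx
  have h3 := O.out_rot_rot_rot hx
  rcases M.vertex_eq_iff.1 hy with rfl | rfl | rfl | rfl
  · simp
  · rcases M.vertex_eq_iff.1 hz with rfl | rfl | rfl | rfl
    · simp
    · simp
    · simp [h2] at oz
    · rw [h3, ← oy] at oz
      simp at oz
  · simp [h2] at oy
  · rcases M.vertex_eq_iff.1 hz with rfl | rfl | rfl | rfl
    · simp
    · rw [h3, ← oz] at oy
      simp at oy
    · simp [h2] at oz
    · simp

variable [Finite D] [DecidableEq D] {S S' : Set M.Vertex} (hS : S ⊆ M.doublePoints)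
  (hS' : S' ⊆ M.doublePoints)

/-- The dart `d` is chosen so that `d` and `M.rot d` both leave or both arrive; the transposition
then cuts the 4-cycle at the vertex into the two pairs that the splice joins. -/
theorem seifertSplice_rot_insert {d : D} (hd : M.AtDoublePoint d)
    (hco : O.out (M.rot d) = O.out d) (hv : M.vertex d ∉ S) (h : S' = insert (M.vertex d) S) :
    (M.seifertSplice O S' hS').rot =
      swap (M.rot d) (M.rot (M.rot (M.rot d))) * (M.seifertSplice O S hS).rot := by
  subst h
  obtain ⟨p0, p1, p2, p3⟩ := seifertPartner_of_coherent O hd hco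
  ext x
  rw [Perm.mul_apply]
  by_cases hx : M.vertex d = M.vertex x
  · rw [seifertSplice_rot_of_mem O hS' (by simp [hx]),
      seifertSplice_rot_of_notMem O hS (by rwa [← hx])]
    rcases M.vertex_eq_iff.1 hx with rfl | rfl | rfl | rfl
    · rw [p0, swap_apply_left]
    · rw [p1, swap_apply_of_ne_of_ne (M.rot_ne _) (M.rot_ne _).symm]
    · rw [p2, swap_apply_right]
    · rw [p3, M.rot_four, swap_apply_of_ne_of_ne (M.rot_ne _).symm (M.rot_rot_rot_ne d).symm]
  · have hne : ∀ y, M.vertex y = M.vertex d → (M.seifertSplice O S hS).rot x ≠ y := by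
      rintro y hy rfl
      apply hx
      rw [← hy]
      exact M.vertex_spliceRot O S x
    rw [swap_apply_of_ne_of_ne (hne _ (by simp [vertex_rot])) (hne _ (by simp [vertex_rot]))]
    by_cases hxS : M.vertex x ∈ S
    · rw [seifertSplice_rot_of_mem O hS' (Or.inr hxS), seifertSplice_rot_of_mem O hS hxS]
    · rw [seifertSplice_rot_of_notMem O hS hxS, seifertSplice_rot_of_notMem O hS']
      rintro (h | h)
      · exact hx h.symm
      · exact hxS h

/-- The transposition of the rotation is conjugated to one of opposite corners, those between two
outgoing and two incoming ends. -/
theorem seifertSplice_facePerm_insert {d : D} (hd : M.AtDoublePoint d)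
    (hco : O.out (M.rot d) = O.out d) (hv : M.vertex d ∉ S) (h : S' = insert (M.vertex d) S) :
    (M.seifertSplice O S' hS').facePerm =
      swap d (M.rot (M.rot d)) * (M.seifertSplice O S hS).facePerm := by
  have h1 := seifertSplice_rot_insert O hS hS' hd hco hv h
  have h2 : M.rot d = (M.seifertSplice O S hS).rot d :=
    (seifertSplice_rot_of_notMem O hS hv).symm
  have h3 : M.rot (M.rot (M.rot d)) = (M.seifertSplice O S hS).rot (M.rot (M.rot d)) :=
    (seifertSplice_rot_of_notMem O hS (by rwa [vertex_rot, vertex_rot])).symm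
  have h4 : (M.seifertSplice O S hS).rot * swap d (M.rot (M.rot d)) =
      swap (M.rot d) (M.rot (M.rot (M.rot d))) * (M.seifertSplice O S hS).rot := by
    rw [mul_swap_eq_swap_mul, ← h2, ← h3]
  rw [← h4] at h1
  ext x
  simp only [facePerm, h1, seifertSplice_edge, Perm.mul_apply, trans_apply]
  rw [Equiv.symm_apply_eq, Perm.mul_apply]
  simp

/-- Only two darts leave a double point, so the spliced curve and the original one, which continue
differently there, exchange `a` and `b`. -/
theorem seifertSplice_outNext_insert {a b : D} (hd : M.AtDoublePoint a) (ha : O.out a = true)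
    (hb : O.out b = true) (hab : a ≠ b) (hvb : M.vertex b = M.vertex a)
    (hv : M.vertex a ∉ S) (h : S' = insert (M.vertex a) S) :
    (O.splice hS').outNext = swap ⟨a, ha⟩ ⟨b, hb⟩ * (O.splice hS).outNext := by
  subst h
  ext ⟨x, hx⟩
  rw [Perm.mul_apply]
  have hnx : ((O.splice hS).outNext ⟨x, hx⟩ : D) = (M.seifertSplice O S hS).next x := rfl
  have hnx' : ((O.splice hS').outNext ⟨x, hx⟩ : D) = (M.seifertSplice O _ hS').next x := rfl
  rw [hnx']
  by_cases hxv : M.vertex (M.edge x) = M.vertex a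
  · have hde : M.AtDoublePoint (M.edge x) := (M.atDoublePoint_congr hxv).2 hd
    rw [seifertSplice_next_of_mem O hS' (by simp [hxv])]
    rw [seifertSplice_next_of_notMem O hS (by rwa [hxv])] at hnx
    have ho : O.out (M.seifertPartner O (M.edge x)) = true := by
      rw [out_seifertPartner O hde, O.out_edge, hx]; rfl
    have ho2 : O.out (M.next x) = true := by rw [O.out_next, hx]
    have hne : M.seifertPartner O (M.edge x) ≠ M.next x := seifertPartner_ne_opp O hde
    have hv1 : M.vertex a = M.vertex (M.seifertPartner O (M.edge x)) := by
      rw [vertex_seifertPartner, hxv]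
    have hv2 : M.vertex a = M.vertex (M.next x) := by rw [vertex_next, hxv]
    have e1 := eq_or_eq_or_eq_of_vertex_eq O hd hvb.symm hv1 (ha.trans hb.symm) (ha.trans ho.symm)
    have e2 := eq_or_eq_or_eq_of_vertex_eq O hd hvb.symm hv2 (ha.trans hb.symm) (ha.trans ho2.symm)
    have e3 := eq_or_eq_or_eq_of_vertex_eq O hd hv1 hv2 (ha.trans ho.symm) (ha.trans ho2.symm)
    rw [swap_apply_def]
    simp only [Subtype.ext_iff, hnx]
    clear hnx hnx' ho ho2 hv1 hv2
    split_ifs with c1 c2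
    · grind
    · grind
    · grind
  · have hne : ∀ (y) (hy : O.out y = true), M.vertex y = M.vertex a →
        (O.splice hS).outNext ⟨x, hx⟩ ≠ ⟨y, hy⟩ := by
      intro y hy hya heq
      apply hxv
      have : (M.seifertSplice O S hS).next x = y := hnx ▸ congrArg Subtype.val heq
      rw [← hya, ← this]
      by_cases hxS : M.vertex (M.edge x) ∈ S
      · rw [seifertSplice_next_of_mem O hS hxS, vertex_seifertPartner]
      · rw [seifertSplice_next_of_notMem O hS hxS, vertex_next]
    rw [swap_apply_of_ne_of_ne (hne _ _ rfl) (hne _ _ hvb), hnx]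
    by_cases hxS : M.vertex (M.edge x) ∈ S
    · rw [seifertSplice_next_of_mem O hS hxS, seifertSplice_next_of_mem O hS' (Or.inr hxS)]
    · rw [seifertSplice_next_of_notMem O hS hxS, seifertSplice_next_of_notMem O hS']
      rintro (h | h)
      · exact hxv h
      · exact hxS h

end Splice

/-! ### Components and regions after one or two splices -/

section SpliceConsequences

variable {D : Type*} {M : CurveMap D} (O : M.Orientation)

theorem exists_outgoing_pair {d : D} (hd : M.AtDoublePoint d) :
    ∃ a b, O.out a = true ∧ O.out b = true ∧ a ≠ b ∧ M.vertex a = M.vertex d ∧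
      M.vertex b = M.vertex d := by
  have h2 := O.out_rot_rot hd
  have h3 := O.out_rot_rot_rot hd
  obtain ⟨a, ha, hva⟩ : ∃ a, O.out a = true ∧ (a = d ∨ a = M.rot (M.rot d)) := by
    cases h : O.out d
    · exact ⟨_, by rw [h2, h]; rfl, Or.inr rfl⟩
    · exact ⟨_, h, Or.inl rfl⟩
  obtain ⟨b, hb, hvb⟩ : ∃ b, O.out b = true ∧ (b = M.rot d ∨ b = M.rot (M.rot (M.rot d))) := by
    cases h : O.out (M.rot d)
    · exact ⟨_, by rw [h3, h]; rfl, Or.inr rfl⟩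
    · exact ⟨_, h, Or.inl rfl⟩
  refine ⟨a, b, ha, hb, ?_, ?_, ?_⟩
  · rcases hva with rfl | rfl <;> rcases hvb with rfl | rfl
    · exact (M.rot_ne _).symm
    · exact (M.rot_rot_rot_ne _).symm
    · exact M.rot_ne _
    · exact (M.rot_ne _).symm
  · rcases hva with rfl | rfl <;> simp [vertex_rot]
  · rcases hvb with rfl | rfl <;> simp [vertex_rot]

theorem exists_coherent {d : D} (hd : M.AtDoublePoint d) :
    ∃ m, M.vertex m = M.vertex d ∧ O.out (M.rot m) = O.out m := by
  by_cases h : O.out (M.rot d) = O.out d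
  · exact ⟨d, rfl, h⟩
  · refine ⟨M.rot d, M.vertex_rot d, ?_⟩
    rw [O.out_rot_rot hd]
    cases h1 : O.out d <;> simp_all

theorem outNext_splice_empty (h : ∅ ⊆ M.doublePoints) : (O.splice h).outNext = O.outNext := by
  ext x
  exact seifertSplice_next_of_notMem O h (Set.notMem_empty _)

variable [Finite D]

/-- A single Seifert splice produces two components. -/
theorem not_oneComponent_seifertSplice_singleton (hM : M.OneComponent) {v : M.Vertex}
    (hS : {v} ⊆ M.doublePoints) : ¬ (M.seifertSplice O {v} hS).OneComponent := by
  classical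
  obtain ⟨d, rfl, hd⟩ := hS rfl
  obtain ⟨a, b, ha, hb, hab, hva, hvb⟩ := exists_outgoing_pair O hd
  intro h
  have h1 := seifertSplice_outNext_insert O (Set.empty_subset _) hS
    ((M.atDoublePoint_congr hva).2 hd) ha hb hab (hvb.trans hva.symm) (Set.notMem_empty _)
    (by rw [hva]; simp)
  rw [outNext_splice_empty] at h1
  have h2 := ((O.splice hS).oneComponent_iff.1 h) ⟨a, ha⟩ ⟨b, hb⟩
  rw [h1] at h2
  exact not_sameCycle_swap_mul (O.oneComponent_iff.1 hM _ _) (fun h => hab (congrArg Subtype.val h))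
    h2

/-- Two Seifert splices at interlaced double points produce one component: the set `T` stands for the
part of the curve between the two passages through the first point. -/
theorem oneComponent_seifertSplice_pair (hM : M.OneComponent) {a b c d : D} {S : Set M.Vertex}
    (hS : S ⊆ M.doublePoints) (hSeq : S = {M.vertex a, M.vertex c})
    (ha : O.out a = true) (hb : O.out b = true)
    (hvb : M.vertex b = M.vertex a) (hc : O.out c = true) (hd : O.out d = true)
    (hvd : M.vertex d = M.vertex c) (hac : M.vertex c ≠ M.vertex a) {T : Set D}
    (haT : a ∈ T) (hbT : b ∉ T) (hT : ∀ x ∈ T, O.out x = true → M.next x ∈ T \ {a} ∨ M.next x = b)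
    (hcT : c ∈ T) (hdT : d ∉ T) : (M.seifertSplice O S hS).OneComponent := by
  classical
  subst hSeq
  have hda : M.AtDoublePoint a := (M.vertex_mem_doublePoints a).1 (hS (by simp))
  have hdc : M.AtDoublePoint c := (M.vertex_mem_doublePoints c).1 (hS (by simp))
  have hab : a ≠ b := fun h => hbT (h ▸ haT)
  have hcd : c ≠ d := fun h => hdT (h ▸ hcT)
  have hS1 : {M.vertex a} ⊆ M.doublePoints := fun v hv => hS (Or.inl hv)
  have h1 := seifertSplice_outNext_insert O (Set.empty_subset _) hS1 hda ha hb hab hvb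
    (Set.notMem_empty _) (by simp)
  rw [outNext_splice_empty] at h1
  have h2 := seifertSplice_outNext_insert O hS1 hS hdc hc hd hcd hvd (by simpa using hac)
    (by rw [Set.pair_comm])
  set f := O.outNext with hf
  set g := (O.splice hS1).outNext with hg
  set a' : {d // O.out d = true} := ⟨a, ha⟩
  set b' : {d // O.out d = true} := ⟨b, hb⟩
  set c' : {d // O.out d = true} := ⟨c, hc⟩
  set d' : {d // O.out d = true} := ⟨d, hd⟩
  -- After the first splice, the walk that left `T` at `b` returns to `a`, so `T` is stable.
  have hTg : ∀ x ∈ {x : {d // O.out d = true} | x.1 ∈ T}, g x ∈ {x | x.1 ∈ T} := by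
    rintro ⟨x, hx⟩ hxT
    rw [h1, Perm.mul_apply, swap_apply_def]
    have hfx : (f ⟨x, hx⟩ : D) = M.next x := rfl
    split_ifs with e1 e2
    · have := hT x hxT hx
      have e3 : M.next x = a := congrArg Subtype.val e1
      rcases this with h | h
      · exact absurd e3 h.2
      · exact absurd (e3.symm.trans h) hab
    · exact haT
    · rcases hT x hxT hx with h | h
      · exact h.1
      · exact absurd (Subtype.ext h) e2
  have hncd : ¬ g.SameCycle c' d' := fun h => hdT (mem_of_sameCycle hTg h hcT)
  have hnb : ¬ g.SameCycle c' b' := fun h => hbT (mem_of_sameCycle hTg h hcT)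
  have hda : ¬ g.SameCycle d' a' := fun h => hdT (mem_of_sameCycle hTg h.symm haT)
  -- The first splice leaves only the components of `a` and `b`: a cycle avoiding both would be a
  -- cycle of the original curve.
  have hall : ∀ z, g.SameCycle z a' ∨ g.SameCycle z b' := by
    intro z
    by_contra! hz
    have hX : ∀ x ∈ {x | g.SameCycle z x}, f x ∈ {x | g.SameCycle z x} := by
      intro x hx
      have h3 : g.SameCycle z (g x) := sameCycle_apply_right.2 hx
      rw [h1, Perm.mul_apply, ← h1, swap_apply_def] at h3
      split_ifs at h3
      · exact absurd h3 hz.2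
      · exact absurd h3 hz.1
      · exact h3
    exact hz.1 (mem_of_sameCycle hX (O.oneComponent_iff.1 hM z a') (SameCycle.refl _ _))
  have hup : ∀ {x y}, g.SameCycle x y → (O.splice hS).outNext.SameCycle x y := by
    intro x y h
    rw [h2]
    exact sameCycle_swap_mul_of_sameCycle hncd h
  have hab' : (O.splice hS).outNext.SameCycle a' b' := by
    have hca := (hall c').resolve_right hnb
    have hdb := (hall d').resolve_left hda
    have hcd' : (O.splice hS).outNext.SameCycle c' d' := by
      rw [h2]
      exact sameCycle_swap_mul hncd
    exact ((hup hca).symm.trans hcd').trans (hup hdb)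
  have hall' : ∀ z, (O.splice hS).outNext.SameCycle z a' := by
    intro z
    rcases hall z with h | h
    · exact hup h
    · exact (hup h).trans hab'.symm
  exact (O.splice hS).oneComponent_iff.2 fun x y => (hall' x).trans (hall' y).symm

/-- If two Seifert splices of a curve on the sphere produce one component, then the result is again
on the sphere, and either splice merges two regions. -/
theorem spherical_seifertSplice_pair (hM : M.Spherical) {x y : D}
    {S : Set M.Vertex} (hS : S ⊆ M.doublePoints) (hSeq : S = {M.vertex x, M.vertex y})
    (hxy : M.vertex y ≠ M.vertex x)
    (hx : O.out (M.rot x) = O.out x) (hy : O.out (M.rot y) = O.out y)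
    (h1 : (M.seifertSplice O S hS).OneComponent) :
    (M.seifertSplice O S hS).Spherical ∧
      (∀ a b, M.facePerm.SameCycle a b → (M.seifertSplice O S hS).facePerm.SameCycle a b) ∧
      (M.seifertSplice O S hS).facePerm.SameCycle x (M.rot (M.rot x)) ∧
      (M.seifertSplice O S hS).facePerm.SameCycle y (M.rot (M.rot y)) := by
  classical
  subst hSeq
  have hdx : M.AtDoublePoint x := (M.vertex_mem_doublePoints x).1 (hS (by simp))
  have hdy : M.AtDoublePoint y := (M.vertex_mem_doublePoints y).1 (hS (by simp))
  have hS1 : {M.vertex x} ⊆ M.doublePoints := fun v hv => hS (Or.inl hv)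
  have r1 := seifertSplice_rot_insert O (Set.empty_subset _) hS1 hdx hx (Set.notMem_empty _)
    (by simp)
  have r2 := seifertSplice_rot_insert O hS1 hS hdy hy (by simpa using hxy)
    (by rw [Set.pair_comm])
  have f1 := seifertSplice_facePerm_insert O (Set.empty_subset _) hS1 hdx hx (Set.notMem_empty _)
    (by simp)
  have f2 := seifertSplice_facePerm_insert O hS1 hS hdy hy (by simpa using hxy)
    (by rw [Set.pair_comm])
  rw [seifertSplice_empty] at r1 f1
  set N₁ := M.seifertSplice O {M.vertex x} hS1 with hN₁
  set N := M.seifertSplice O {M.vertex x, M.vertex y} hS with hN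
  have euler : cycleCount N.rot + cycleCount N.facePerm ≤ cycleCount M.edge + 2 :=
    h1.isConnected.euler_le (O.splice hS).sign_mem_chains (O.splice hS).sign_ne_zero
  have v1 : cycleCount M.rot < cycleCount N₁.rot := by
    rw [r1]
    refine cycleCount_lt_swap_mul ?_ (rot_ne_rot_rot_rot hdx)
    simp [SameCycle.refl]
  have v2 : cycleCount N₁.rot < cycleCount N.rot := by
    rw [r2]
    refine cycleCount_lt_swap_mul ?_ (rot_ne_rot_rot_rot hdy)
    have hv : M.vertex (M.rot y) ∉ ({M.vertex x} : Set M.Vertex) := by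
      rw [vertex_rot]; simpa using hxy
    rw [← seifertSplice_rot_rot_of_notMem O hS1 hv, ← hN₁]
    simp [SameCycle.refl]
  have c1 := cycleCount_le_swap_mul M.facePerm x (M.rot (M.rot x))
  have c2 := cycleCount_le_swap_mul N₁.facePerm y (M.rot (M.rot y))
  rw [← f1] at c1
  rw [← f2] at c2
  have hM' := hM
  rw [Spherical] at hM'
  -- There are now two vertices more and at most two regions fewer. A splice that split a region
  -- would make V + F exceed the bound `euler`.
  have m1 : ¬ M.facePerm.SameCycle x (M.rot (M.rot x)) := fun h => by
    have := cycleCount_lt_swap_mul h (fun h => hdx h.symm)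
    rw [← f1] at this
    omega
  have m2 : ¬ N₁.facePerm.SameCycle y (M.rot (M.rot y)) := fun h => by
    have := cycleCount_lt_swap_mul h (fun h => hdy h.symm)
    rw [← f2] at this
    omega
  have up1 : ∀ a b, M.facePerm.SameCycle a b → N₁.facePerm.SameCycle a b := fun a b h => by
    rw [f1]
    exact sameCycle_swap_mul_of_sameCycle m1 h
  have up2 : ∀ a b, N₁.facePerm.SameCycle a b → N.facePerm.SameCycle a b := fun a b h => by
    rw [f2]
    exact sameCycle_swap_mul_of_sameCycle m2 h
  refine ⟨?_, fun a b h => up2 _ _ (up1 _ _ h), up2 _ _ ?_, ?_⟩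
  · have e : cycleCount N.edge = cycleCount M.edge := rfl
    rw [Spherical, e]
    omega
  · rw [f1]
    exact sameCycle_swap_mul m1
  · rw [f2]
    exact sameCycle_swap_mul m2

end SpliceConsequences

/-! ### A circle separates the sphere -/

namespace Circle

variable {D : Type*} {M : CurveMap D} {k : ℕ} [NeZero k] (C : M.Circle k)

theorem vertex_dart_mem (i : Fin k) : M.vertex (C.dart i) ∈ C.points := ⟨i, rfl⟩

open Classical in
/-- The indicator function of the darts on the left-hand side of the circle. -/
noncomputable def leftIndicator (d : D) : ℝ :=
  ∑ i, ((if d = M.rot (C.dart i) then 1 else 0) + if d = M.rot (M.rot (C.dart i)) then 1 else 0)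

theorem leftIndicator_of_notMem {d : D} (h : M.vertex d ∉ C.points) : C.leftIndicator d = 0 := by
  refine Finset.sum_eq_zero fun i _ => ?_
  rw [if_neg, if_neg, add_zero]
  · rintro rfl
    exact h ⟨i, by simp [vertex_rot]⟩
  · rintro rfl
    exact h ⟨i, by simp [vertex_rot]⟩

open Classical in
theorem leftIndicator_of_vertex_eq {d : D} {i : Fin k} (h : M.vertex d = M.vertex (C.dart i)) :
    C.leftIndicator d =
      (if d = M.rot (C.dart i) then 1 else 0) + if d = M.rot (M.rot (C.dart i)) then 1 else 0 := by
  refine Finset.sum_eq_single i (fun j _ hj => ?_) (by simp)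
  have hne : M.vertex d ≠ M.vertex (C.dart j) := fun h2 =>
    hj (C.vertex_injective (h2.symm.trans h))
  rw [if_neg, if_neg, add_zero]
  · rintro rfl
    exact hne (by simp [vertex_rot])
  · rintro rfl
    exact hne (by simp [vertex_rot])

theorem leftIndicator_dart (i : Fin k) : C.leftIndicator (C.dart i) = 0 := by
  rw [C.leftIndicator_of_vertex_eq rfl, if_neg (M.rot_ne _).symm,
    if_neg (fun h => C.atDoublePoint i h.symm), add_zero]

theorem leftIndicator_rot (i : Fin k) : C.leftIndicator (M.rot (C.dart i)) = 1 := by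
  rw [C.leftIndicator_of_vertex_eq (M.vertex_rot _), if_pos rfl, if_neg (M.rot_ne _).symm, add_zero]

theorem leftIndicator_rot_rot (i : Fin k) : C.leftIndicator (M.rot (M.rot (C.dart i))) = 1 := by
  rw [C.leftIndicator_of_vertex_eq (i := i) (by simp [vertex_rot]), if_neg (M.rot_ne _), if_pos rfl,
    zero_add]

theorem leftIndicator_rot_rot_rot (i : Fin k) :
    C.leftIndicator (M.rot (M.rot (M.rot (C.dart i)))) = 0 := by
  rw [C.leftIndicator_of_vertex_eq (i := i) (by simp [vertex_rot]), if_neg, if_neg (M.rot_ne _),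
    add_zero]
  exact fun h => C.atDoublePoint i (M.rot.injective h)

theorem sum_leftIndicator_mul [Fintype D] (u : D → ℝ) :
    ∑ d, C.leftIndicator d * u d =
      ∑ i, (u (M.rot (C.dart i)) + u (M.rot (M.rot (C.dart i)))) := by
  simp only [leftIndicator, Finset.sum_mul]
  rw [Finset.sum_comm]
  refine Finset.sum_congr rfl fun i _ => ?_
  classical
  simp [add_mul, Finset.sum_add_distrib]

/-- Each passage of the circle leaves one region and enters another, and around the closed circle
these contributions cancel. -/
theorem sum_diff_leftIndicator_mul [Fintype D] {u : D → ℝ} (hu : u ∈ invariants M.facePerm) :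
    ∑ d, M.diff C.leftIndicator d * u d = 0 := by
  have h1 := M.sum_edge (fun d => C.leftIndicator d * u (M.edge d))
  simp only [M.edge_edge] at h1
  have h2 : ∀ d, u (M.edge (M.rot d)) = u d := fun d => by
    rw [← hu]
    simp [facePerm, M.edge_edge]
  have h3 : ∀ i, u (C.dart i) = u (M.rot (M.rot (C.dart (i + 1)))) := fun i =>
    eq_of_sameCycle hu (Quotient.exact (s := SameCycle.setoid M.facePerm) (C.face_eq i))
  have h4 := Equiv.sum_comp (Equiv.addRight (1 : Fin k))
    (fun i => u (M.rot (M.rot (C.dart i))))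
  simp only [diff, LinearMap.coe_mk, AddHom.coe_mk, sub_mul, Finset.sum_sub_distrib, h1,
    sum_leftIndicator_mul, h2, Finset.sum_add_distrib]
  simp only [Equiv.coe_addRight] at h4
  simp only [h3, h4]
  ring

variable [Finite D]

/-- Being orthogonal to all region boundaries, the coboundary of the left indicator is that of a
vertex function `g`; the difference `s` is then a function on the edges. Up to a constant, `s` will
tell the two sides apart. -/
theorem exists_side (hs : M.Spherical) (hM : M.OneComponent) (O : M.Orientation) :
    ∃ g s : D → ℝ, (∀ d, g (M.rot d) = g d) ∧ (∀ d, s (M.edge d) = s d) ∧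
      ∀ d, C.leftIndicator d = s d + g d := by
  have := Fintype.ofFinite D
  obtain ⟨g, hg, hgl⟩ := hs.exists_diff_eq hM.isConnected O.sign_mem_chains O.sign_ne_zero
    (M.diff_mem_chains C.leftIndicator) (fun u hu => C.sum_diff_leftIndicator_mul hu)
  refine ⟨g, C.leftIndicator - g, hg, fun d => ?_, fun d => by simp⟩
  have := congrFun hgl d
  simp only [diff, LinearMap.coe_mk, AddHom.coe_mk] at this
  simp only [Pi.sub_apply]
  linarith

/-- As much of the curve arrives on the left-hand side of the circle as leaves it there. -/
theorem sum_sign_eq_zero (hs : M.Spherical) (hM : M.OneComponent) (O : M.Orientation) :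
    ∑ i, (O.sign (M.rot (C.dart i)) + O.sign (M.rot (M.rot (C.dart i)))) = 0 := by
  have := Fintype.ofFinite D
  obtain ⟨g, s, hg, hs, hl⟩ := C.exists_side hs hM O
  rw [← sum_leftIndicator_mul]
  -- The part with `s` cancels between the two ends of each edge, the part with `g` between opposite
  -- darts at each vertex.
  have h1 := M.sum_edge (fun d => s d * O.sign d)
  have h2 : ∑ d, g (M.opp d) * O.sign (M.opp d) = ∑ d, g d * O.sign d :=
    Equiv.sum_comp (Function.Involutive.toPerm M.opp M.opp_opp) (fun d => g d * O.sign d)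
  have h3 : ∀ d, g (M.opp d) = g d := fun d => by
    unfold opp
    split_ifs <;> simp [hg]
  have h4 : ∀ d, O.sign (M.edge d) = - O.sign d := O.sign_mem_chains
  simp only [h4, hs] at h1
  simp only [O.sign_opp, h3] at h2
  simp only [mul_neg, Finset.sum_neg_distrib] at h1 h2
  simp only [hl, add_mul, Finset.sum_add_distrib]
  linarith

/-- Around a region, `s` can jump only where the circle passes, which is once on entering and once
on leaving. Between these corners `s` is constant, and at them it equals `-g` of the respective
vertex. -/
theorem side_dart_succ {g s : D → ℝ} (hg : ∀ d, g (M.rot d) = g d)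
    (hs : ∀ d, s (M.edge d) = s d) (hl : ∀ d, C.leftIndicator d = s d + g d) (i : Fin k) :
    g (C.dart i) = g (C.dart (i + 1)) := by
  have hsl : ∀ d, s d = C.leftIndicator d - g d := fun d => by rw [hl]; ring
  have hface : M.facePerm.SameCycle (C.dart i) (M.rot (M.rot (C.dart (i + 1)))) :=
    Quotient.exact (s := SameCycle.setoid M.facePerm) (C.face_eq i)
  set y := M.facePerm.symm (M.rot (M.rot (C.dart (i + 1)))) with hy
  have hφy : M.facePerm y = M.rot (M.rot (C.dart (i + 1))) := by simp [hy]
  have hey : M.edge y = M.rot (M.rot (M.rot (C.dart (i + 1)))) := by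
    rw [← M.rot_facePerm, hφy]
  have hsy : s y = - g (C.dart (i + 1)) := by
    rw [← hs, hey, hsl, leftIndicator_rot_rot_rot, hg, hg, hg, zero_sub]
  have hsd : s (C.dart i) = - g (C.dart i) := by
    rw [hsl, leftIndicator_dart, zero_sub]
  by_contra hne
  -- If the values differed, the walk from `C.dart i` could never reach the entering corner with its
  -- initial value of `s`. It would keep that value until it came back to `C.dart i`, where the
  -- preceding edge lies on the left and has value larger by 1.
  have hX : ∀ x ∈ {x | M.facePerm.SameCycle (C.dart i) x ∧ s x = s (C.dart i)},
      M.facePerm x ∈ {x | M.facePerm.SameCycle (C.dart i) x ∧ s x = s (C.dart i)} := by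
    rintro x ⟨hx, hsx⟩
    refine ⟨sameCycle_apply_right.2 hx, ?_⟩
    have hrot : s (M.rot (M.facePerm x)) = s x := by rw [M.rot_facePerm, hs]
    have hc : M.facePerm.SameCycle (C.dart i) (M.facePerm x) := sameCycle_apply_right.2 hx
    have hfc : M.face (C.dart i) = M.face (M.facePerm x) :=
      Quotient.sound (s := SameCycle.setoid M.facePerm) hc
    by_cases hp : M.vertex (M.facePerm x) ∈ C.points
    · obtain ⟨j, hj⟩ := hp
      rcases M.vertex_eq_iff.1 hj with h | h | h | h
      · rw [h] at hfc ⊢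
        rw [C.face_injective hfc]
      · rw [← hsx, ← hrot, hsl, hsl, hg, h, leftIndicator_rot_rot, leftIndicator_rot]
      · exfalso
        obtain ⟨j, rfl⟩ : ∃ j', j = j' + 1 := ⟨j - 1, by simp⟩
        rw [h, ← C.face_eq j] at hfc
        rw [← C.face_injective hfc, ← hφy] at h
        rw [M.facePerm.injective h, hsy, hsd] at hsx
        exact hne (by linarith)
      · rw [← hsx, ← hrot, hsl, hsl, hg, h, M.rot_four, leftIndicator_dart,
          leftIndicator_rot_rot_rot]
    · rw [← hsx, ← hrot, hsl, hsl, hg, C.leftIndicator_of_notMem hp,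
        C.leftIndicator_of_notMem (by rwa [vertex_rot])]
  have h1 := mem_of_apply_mem hX (x := M.facePerm.symm (C.dart i))
    (by simpa using SameCycle.refl _ _)
  have h2 := h1.2
  rw [← hs, ← M.rot_facePerm, Equiv.apply_symm_apply, hsl, hsl, leftIndicator_rot,
    leftIndicator_dart, hg] at h2
  linarith

/-- A circle separates the sphere: a function on the edges that is `1` on the left-hand side of the
circle and `0` on its right-hand side. -/
theorem exists_separation (hs : M.Spherical) (hM : M.OneComponent) (O : M.Orientation) :
    ∃ s : D → ℝ, (∀ d, s (M.edge d) = s d) ∧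
      (∀ d, M.vertex d ∉ C.points → s (M.opp d) = s d) ∧
      ∀ l i b, s (C.branchEnd l i b) = if l then 1 else 0 := by
  obtain ⟨g, s, hg, hs, hl⟩ := C.exists_side hs hM O
  have hconst : ∀ i, g (C.dart i) = g (C.dart 0) := by
    have hsucc := C.side_dart_succ hg hs hl
    obtain ⟨n, rfl⟩ := Nat.exists_eq_succ_of_ne_zero (NeZero.ne k)
    intro i
    induction i using Fin.induction with
    | zero => rfl
    | succ i ih =>
      have h := hsucc i.castSucc
      rw [Fin.coeSucc_eq_succ] at h
      rw [← h, ih]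
  have hsl : ∀ d, s d = C.leftIndicator d - g d := fun d => by rw [hl]; ring
  -- At the points of the circle `g` equals this constant, so adding it to `s` gives exactly the
  -- left indicator there.
  refine ⟨fun d => s d + g (C.dart 0), fun d => by simp only [hs],
    fun d hd => ?_, fun l i b => ?_⟩
  · have h3 : g (M.opp d) = g d := by
      unfold opp
      split_ifs <;> simp [hg]
    simp only [hsl, h3]
    rw [C.leftIndicator_of_notMem hd,
      C.leftIndicator_of_notMem (by rwa [vertex_opp])]
  · cases l <;> cases b <;>
      simp [branchEnd, hsl, hg, hconst i, leftIndicator_dart, leftIndicator_rot,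
        leftIndicator_rot_rot, leftIndicator_rot_rot_rot]

end Circle

/-! ### Arcs of the curve between passages through a circle -/

namespace Circle

variable {D : Type*} {M : CurveMap D} {k : ℕ} [NeZero k] (C : M.Circle k)

/-- The darts passed by the arc of the curve that leaves along `x`, until it meets the circle. -/
def arc (x : D) : Set D :=
  {z | ∃ n : ℕ, M.next^[n] x = z ∧ ∀ m < n, M.vertex (M.edge (M.next^[m] x)) ∉ C.points}

theorem self_mem_arc (x : D) : x ∈ C.arc x := ⟨0, rfl, by simp⟩

variable {C}

theorem next_mem_arc {x z : D} (hz : z ∈ C.arc x) (h : M.vertex (M.edge z) ∉ C.points) :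
    M.next z ∈ C.arc x := by
  obtain ⟨n, rfl, hn⟩ := hz
  refine ⟨n + 1, Function.iterate_succ_apply' .., fun m hm => ?_⟩
  rcases Nat.lt_succ_iff_lt_or_eq.1 hm with h1 | rfl
  · exact hn m h1
  · exact h

theorem connects_of_mem_arc {x z : D} (hz : z ∈ C.arc x) (h : M.vertex (M.edge z) ∈ C.points) :
    C.Connects x (M.edge z) := by
  obtain ⟨n, rfl, hn⟩ := hz
  exact ⟨n, rfl, h, hn⟩

theorem Connects.exists_mem_arc {x y : D} (h : C.Connects x y) : ∃ z ∈ C.arc x, M.edge z = y := by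
  obtain ⟨n, rfl, -, hn⟩ := h
  exact ⟨_, ⟨n, rfl, hn⟩, rfl⟩

theorem Connects.vertex_mem {x y : D} (h : C.Connects x y) : M.vertex y ∈ C.points := by
  obtain ⟨n, -, hy, -⟩ := h
  exact hy

theorem eq_or_exists_of_mem_arc {x z : D} (hz : z ∈ C.arc x) :
    z = x ∨ M.vertex z ∉ C.points ∧ ∃ w ∈ C.arc x, M.next w = z := by
  obtain ⟨n, rfl, hn⟩ := hz
  rcases n with _ | n
  · exact Or.inl rfl
  · refine Or.inr ⟨?_, M.next^[n] x, ⟨n, rfl, fun m hm => hn m (by omega)⟩,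
      (Function.iterate_succ_apply' ..).symm⟩
    rw [Function.iterate_succ_apply', vertex_next]
    exact hn n (by omega)

theorem eq_of_mem_arc {x z : D} (hz : z ∈ C.arc x) (h : M.vertex z ∈ C.points) : z = x := by
  rcases eq_or_exists_of_mem_arc hz with h1 | h1
  · exact h1
  · exact absurd h h1.1

theorem apply_eq_of_mem_arc {β : Type*} {u : D → β} (h1 : ∀ d, u (M.edge d) = u d)
    (h2 : ∀ d, M.vertex d ∉ C.points → u (M.opp d) = u d) {x z : D} (hz : z ∈ C.arc x) :
    u z = u x := by
  obtain ⟨n, rfl, hn⟩ := hz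
  induction n with
  | zero => rfl
  | succ n ih =>
    rw [Function.iterate_succ_apply', next, h2 _ (hn n (by omega)), h1,
      ih fun m hm => hn m (by omega)]

theorem out_of_mem_arc (O : M.Orientation) {x z : D} (hz : z ∈ C.arc x) : O.out z = O.out x := by
  obtain ⟨n, rfl, -⟩ := hz
  exact O.out_next_iterate n x

theorem Connects.out_eq (O : M.Orientation) {x y : D} (h : C.Connects x y) :
    O.out y = !O.out x := by
  obtain ⟨z, hz, rfl⟩ := h.exists_mem_arc
  rw [O.out_edge, out_of_mem_arc O hz]

theorem Connects.unique {x y z : D} (hy : C.Connects x y) (hz : C.Connects x z) : y = z := by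
  obtain ⟨n, rfl, h1, h2⟩ := hy
  obtain ⟨m, rfl, h3, h4⟩ := hz
  rcases lt_trichotomy n m with h | rfl | h
  · exact absurd h1 (h4 n h)
  · rfl
  · exact absurd h3 (h2 m h)

theorem Connects.symm {x y : D} (h : C.Connects x y) (hx : M.vertex x ∈ C.points) :
    C.Connects y x := by
  obtain ⟨n, rfl, -, h2⟩ := h
  have key : ∀ m ≤ n, M.next^[m] (M.edge (M.next^[n] x)) = M.edge (M.next^[n - m] x) := by
    intro m hm
    conv_lhs => rw [← Nat.add_sub_cancel' hm, Function.iterate_add_apply]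
    rw [next_iterate_edge]
  refine ⟨n, ?_, hx, fun m hm => ?_⟩
  · rw [next_iterate_edge, M.edge_edge]
  · rw [key m hm.le, M.edge_edge, show n - m = (n - m - 1) + 1 by omega,
      Function.iterate_succ_apply', vertex_next]
    exact h2 _ (by omega)

theorem exists_connects [Finite D] {x : D} (hx : M.vertex x ∈ C.points) : ∃ y, C.Connects x y := by
  classical
  have hex : ∃ n, M.vertex (M.edge (M.next^[n] x)) ∈ C.points := by
    -- The walk is periodic, so at the latest it meets the circle on its return to `x`.
    obtain ⟨n, -, hn⟩ := (sameCycle_apply_left.2 (SameCycle.refl M.nextPerm x)).exists_pow_eq'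
    rw [← Perm.iterate_eq_pow, ← Function.iterate_succ_apply, Function.iterate_succ_apply'] at hn
    refine ⟨n, ?_⟩
    rw [← vertex_next]
    change M.vertex (M.nextPerm (M.nextPerm^[n] x)) ∈ _
    rwa [hn]
  exact ⟨_, Nat.find hex, rfl, Nat.find_spec hex, fun m hm => Nat.find_min hex hm⟩

/-- A set of darts at the circle that contains with the start of an arc of the curve also the start
of the following arc contains the starts of all arcs. -/
theorem exists_mem_arc_of_closed [Finite D] (hM : M.OneComponent) (O : M.Orientation) {Y : Set D}
    (hYo : ∀ x ∈ Y, O.out x = true) (hY : ∀ x ∈ Y, ∀ y, C.Connects x y → M.opp y ∈ Y)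
    (hne : Y.Nonempty) {z : D} (hz : O.out z = true) : ∃ x ∈ Y, z ∈ C.arc x := by
  obtain ⟨x₀, hx₀⟩ := hne
  obtain ⟨n, -, hn⟩ := (O.oneComponent_iff.1 hM ⟨x₀, hYo x₀ hx₀⟩ ⟨z, hz⟩).exists_pow_eq'
  have hn' : M.next^[n] x₀ = z := by rw [← O.coe_outNext_pow n ⟨x₀, hYo x₀ hx₀⟩, hn]
  subst hn'
  clear hn hz
  induction n with
  | zero => exact ⟨x₀, hx₀, C.self_mem_arc x₀⟩
  | succ n ih =>
    obtain ⟨x, hx, hz⟩ := ih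
    rw [Function.iterate_succ_apply']
    by_cases h : M.vertex (M.edge (M.next^[n] x₀)) ∈ C.points
    · exact ⟨_, hY x hx _ (connects_of_mem_arc hz h), C.self_mem_arc _⟩
    · exact ⟨x, hx, next_mem_arc hz h⟩

theorem mem_of_closed [Finite D] (hM : M.OneComponent) (O : M.Orientation) {Y : Set D}
    (hYo : ∀ x ∈ Y, O.out x = true) (hY : ∀ x ∈ Y, ∀ y, C.Connects x y → M.opp y ∈ Y)
    (hne : Y.Nonempty) {z : D} (hz : O.out z = true) (hzC : M.vertex z ∈ C.points) : z ∈ Y := by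
  obtain ⟨x, hx, hzx⟩ := exists_mem_arc_of_closed hM O hYo hY hne hz
  rwa [eq_of_mem_arc hzx hzC]

variable (C)

theorem vertex_branchEnd (s : Bool) (i : Fin k) (b : Bool) :
    M.vertex (C.branchEnd s i b) = M.vertex (C.dart i) := by
  cases s <;> cases b <;> simp [branchEnd, vertex_rot]

theorem vertex_branchEnd_mem (s : Bool) (i : Fin k) (b : Bool) :
    M.vertex (C.branchEnd s i b) ∈ C.points := ⟨i, (C.vertex_branchEnd s i b).symm⟩

theorem opp_branchEnd (s : Bool) (i : Fin k) (b : Bool) :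
    M.opp (C.branchEnd s i b) = C.branchEnd (!s) i b := by
  rw [M.opp_of_atDoublePoint ((M.atDoublePoint_congr (C.vertex_branchEnd s i b)).2
    (C.atDoublePoint i))]
  cases s <;> cases b <;> simp [branchEnd, M.rot_four]

theorem exists_eq_branchEnd [Finite D] {d : D} (h : M.vertex d ∈ C.points) :
    ∃ s i b, d = C.branchEnd s i b := by
  obtain ⟨i, hi⟩ := h
  rcases M.vertex_eq_iff.1 hi with h | h | h | h
  · exact ⟨false, i, true, h⟩
  · exact ⟨true, i, false, h⟩
  · exact ⟨true, i, true, h⟩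
  · exact ⟨false, i, false, h⟩

theorem branchEnd_inj {s t : Bool} {i j : Fin k} {b c : Bool}
    (h : C.branchEnd s i b = C.branchEnd t j c) : s = t ∧ i = j ∧ b = c := by
  have hv : M.vertex (C.dart i) = M.vertex (C.dart j) := by
    rw [← C.vertex_branchEnd s i b, h, C.vertex_branchEnd]
  obtain rfl := C.vertex_injective hv
  have h1 : ∀ d, d ≠ M.rot d := fun d => (M.rot_ne d).symm
  have h2 : M.rot (M.rot (C.dart i)) ≠ C.dart i := C.atDoublePoint i
  have h3 := M.rot_rot_rot_ne (C.dart i)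
  have h4 := M.rot_ne
  cases s <;> cases t <;> cases b <;> cases c <;> simp_all [branchEnd, h2.symm, h3.symm]

/-- The two branches of the oriented curve cross the circle in opposite directions at each of its
points; `e i` is the one that leaves to the left at the `i`-th point. -/
def Coherent (O : M.Orientation) (e : Fin k → Bool) : Prop :=
  ∀ s i b, O.out (C.branchEnd s i b) = (b ^^ (e i ^^ s))

/-- The dart along which the curve leaves the `i`-th point to the side `s` of the circle. -/
def outEnd (e : Fin k → Bool) (s : Bool) (i : Fin k) : D := C.branchEnd s i (e i ^^ !s)

/-- The dart along which the curve arrives at the `i`-th point from the side `s` of the circle. -/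
def inEnd (e : Fin k → Bool) (s : Bool) (i : Fin k) : D := C.branchEnd s i (e i ^^ s)

variable {C} {O : M.Orientation} {e : Fin k → Bool}

theorem opp_inEnd (s : Bool) (i : Fin k) : M.opp (C.inEnd e s i) = C.outEnd e (!s) i := by
  rw [inEnd, opp_branchEnd, outEnd, Bool.not_not]

theorem vertex_inEnd (s : Bool) (i : Fin k) :
    M.vertex (C.inEnd e s i) = M.vertex (C.dart i) := C.vertex_branchEnd ..

theorem vertex_outEnd (s : Bool) (i : Fin k) :
    M.vertex (C.outEnd e s i) = M.vertex (C.dart i) := C.vertex_branchEnd ..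

theorem vertex_outEnd_mem (s : Bool) (i : Fin k) : M.vertex (C.outEnd e s i) ∈ C.points :=
  C.vertex_branchEnd_mem ..

theorem outEnd_inj {s t : Bool} {i j : Fin k} (h : C.outEnd e s i = C.outEnd e t j) :
    s = t ∧ i = j := by
  obtain ⟨h1, h2, -⟩ := C.branchEnd_inj h
  exact ⟨h1, h2⟩

theorem coherent_iff : C.Coherent O (fun i => !O.out (C.dart i)) ↔
    ∀ i, O.out (M.rot (C.dart i)) = O.out (C.dart i) := by
  constructor
  · intro h i
    simpa [branchEnd] using h true i false
  · intro h s i b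
    have h2 := O.out_rot_rot (C.atDoublePoint i)
    have h3 := O.out_rot_rot_rot (C.atDoublePoint i)
    cases s <;> cases b <;> simp [branchEnd, h2, h3, h i]

namespace Coherent

theorem out_outEnd (h : C.Coherent O e) (s : Bool) (i : Fin k) :
    O.out (C.outEnd e s i) = true := by
  rw [outEnd, h]
  cases e i <;> cases s <;> rfl

theorem out_rot_dart (h : C.Coherent O e) (i : Fin k) :
    O.out (M.rot (C.dart i)) = O.out (C.dart i) := by
  have h1 := h true i false
  have h2 := h false i true
  simp only [branchEnd] at h1 h2
  rw [h1, h2]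
  simp

theorem seifertPartner_inEnd (h : C.Coherent O e) (s : Bool) (i : Fin k) :
    M.seifertPartner O (C.inEnd e s i) = C.outEnd e s i := by
  obtain ⟨h0, h1, h2, h3⟩ := seifertPartner_of_coherent O (C.atDoublePoint i) (h.out_rot_dart i)
  cases s <;> cases he : e i <;> simp [inEnd, outEnd, branchEnd, h0, h1, h2, h3, he]

theorem exists_eq_inEnd [Finite D] (h : C.Coherent O e) {d : D} (hd : M.vertex d ∈ C.points)
    (ho : O.out d = false) : ∃ s i, d = C.inEnd e s i := by
  obtain ⟨s, i, b, rfl⟩ := C.exists_eq_branchEnd hd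
  refine ⟨s, i, ?_⟩
  rw [h] at ho
  rw [inEnd]
  congr 1
  revert ho
  cases b <;> cases e i <;> cases s <;> simp

/-- The arcs of the curve on either side of the circle join its points in pairs. -/
theorem exists_connects_inEnd [Finite D] (h : C.Coherent O e) (hs : M.Spherical)
    (hM : M.OneComponent) (s : Bool) (i : Fin k) :
    ∃ j, C.Connects (C.outEnd e s i) (C.inEnd e s j) := by
  obtain ⟨u, h1, h2, h3⟩ := C.exists_separation hs hM O
  obtain ⟨y, hy⟩ := exists_connects (C := C) (x := C.outEnd e s i) (vertex_outEnd_mem s i)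
  have ho := hy.out_eq O
  rw [h.out_outEnd] at ho
  obtain ⟨t, j, rfl⟩ := h.exists_eq_inEnd hy.vertex_mem ho
  obtain ⟨z, hz, hzy⟩ := hy.exists_mem_arc
  have h4 := apply_eq_of_mem_arc h1 h2 hz
  rw [← h1 z, hzy, inEnd, outEnd, h3, h3] at h4
  have hst : t = s := by
    cases s <;> cases t <;> simp_all
  subst hst
  exact ⟨j, hy⟩

/-- Reduces the topology to combinatorics: on each side the arcs give a permutation of the points,
and since the curve changes sides at every passage, having one component means that alternating the
two permutations reaches every pair of a side and a point. -/
theorem exists_arcs [Finite D] (h : C.Coherent O e) (hs : M.Spherical)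
    (hM : M.OneComponent) :
    ∃ π : Bool → Fin k → Fin k,
      (∀ s i, C.Connects (C.outEnd e s i) (C.inEnd e s (π s i))) ∧
      (∀ s, Function.Injective (π s)) ∧
      ∀ Y : Bool → Fin k → Prop, (∀ s i, Y s i → Y (!s) (π s i)) → (∃ s i, Y s i) →
        ∀ s i, Y s i := by
  choose π hπ using h.exists_connects_inEnd hs hM
  refine ⟨π, hπ, fun s i j hij => ?_, fun Y hY ⟨s₀, i₀, h₀⟩ s i => ?_⟩
  · have h1 := (hπ s i).symm (vertex_outEnd_mem s i)
    have h2 := (hπ s j).symm (vertex_outEnd_mem s j)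
    rw [← hij] at h2
    exact (outEnd_inj (h1.unique h2)).2
  · have := mem_of_closed (C := C) hM O (Y := {x | ∃ s i, Y s i ∧ x = C.outEnd e s i})
      (by rintro _ ⟨s, i, -, rfl⟩; exact h.out_outEnd s i)
      (by
        rintro _ ⟨s, i, hsi, rfl⟩ y hy
        rw [hy.unique (hπ s i), opp_inEnd]
        exact ⟨_, _, hY s i hsi, rfl⟩)
      ⟨_, s₀, i₀, h₀, rfl⟩ (h.out_outEnd s i) (vertex_outEnd_mem s i)
    obtain ⟨t, j, htj, heq⟩ := this
    obtain ⟨rfl, rfl⟩ := outEnd_inj heq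
    exact htj

end Coherent

end Circle

/-! ### Nugatory crossings and the lower bound -/

section Reducible

variable {D : Type*} {M : CurveMap D}

theorem hasNugatoryCrossing_of_face_eq {d : D} (hd : M.AtDoublePoint d)
    (h : M.face d = M.face (M.rot (M.rot d))) : M.HasNugatoryCrossing :=
  ⟨{ dart := fun _ => d
     atDoublePoint := fun _ => hd
     vertex_injective := fun _ _ _ => Subsingleton.elim _ _
     face_eq := fun _ => h
     face_injective := fun _ _ _ => Subsingleton.elim _ _ }⟩

theorem face_eq_of_sameCycle {x y : D} (h : M.facePerm.SameCycle x y) : M.face x = M.face y :=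
  Quotient.sound (s := SameCycle.setoid M.facePerm) h

theorem sameCycle_of_face_eq {x y : D} (h : M.face x = M.face y) : M.facePerm.SameCycle x y :=
  Quotient.exact (s := SameCycle.setoid M.facePerm) h

variable [Finite D]

/-- A double point is nugatory if a union of edges contains exactly two neighbouring darts at it and
is a union of components away from it. -/
theorem face_eq_of_closed {A : Set D} {d : D}
    (hA : ∀ x ∈ A, M.edge x ∈ A)
    (hrot : ∀ x ∈ A, M.vertex x ≠ M.vertex d → M.rot x ∈ A) (h0 : d ∉ A) (h1 : M.rot d ∈ A)
    (h2 : M.rot (M.rot d) ∈ A) (h3 : M.rot (M.rot (M.rot d)) ∉ A) :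
    M.face d = M.face (M.rot (M.rot d)) := by
  by_contra hne
  have hn : ¬ M.facePerm.SameCycle (M.rot (M.rot d)) d := fun h =>
    hne (face_eq_of_sameCycle h).symm
  -- The walk around the region starting at `M.rot (M.rot d)` stays in `A` unless it reaches `d`. If
  -- it never did, it would close up inside `A`, and its last edge would put the excluded dart at
  -- this vertex into `A`.
  have hX : ∀ x ∈ {x | x ∈ A ∧ M.facePerm.SameCycle (M.rot (M.rot d)) x},
      M.facePerm x ∈ {x | x ∈ A ∧ M.facePerm.SameCycle (M.rot (M.rot d)) x} := by
    rintro x ⟨hx, hs⟩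
    have hs' : M.facePerm.SameCycle (M.rot (M.rot d)) (M.facePerm x) := sameCycle_apply_right.2 hs
    refine ⟨?_, hs'⟩
    have he := hA x hx
    rw [← M.rot_facePerm] at he
    by_cases hv : M.vertex d = M.vertex (M.facePerm x)
    · rcases M.vertex_eq_iff.1 hv with h | h | h | h
      · rw [h] at hs'
        exact absurd hs' hn
      · rwa [h]
      · rwa [h]
      · rw [h, M.rot_four] at he
        exact absurd he h0
    · have hw : ∀ y, M.vertex y = M.vertex (M.facePerm x) → M.vertex y ≠ M.vertex d :=
        fun y hy h => hv (h.symm.trans hy)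
      have := hrot _ (hrot _ (hrot _ he (hw _ (by simp [vertex_rot]))) (hw _ (by simp [vertex_rot])))
        (hw _ (by simp [vertex_rot]))
      rwa [M.rot_four] at this
  have h4 := mem_of_apply_mem hX (x := M.facePerm.symm (M.rot (M.rot d)))
    (by simpa using ⟨h2, SameCycle.refl _ _⟩)
  have h5 := hA _ h4.1
  rw [← M.rot_facePerm, Equiv.apply_symm_apply] at h5
  exact h3 h5

variable (O : M.Orientation)

theorem isReducible_seifertSplice_pair (hM : M.Spherical) {x y d : D}
    {S : Set M.Vertex} (hS : S ⊆ M.doublePoints) (hSeq : S = {M.vertex x, M.vertex y})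
    (hxy : M.vertex y ≠ M.vertex x)
    (hx : O.out (M.rot x) = O.out x) (hy : O.out (M.rot y) = O.out y)
    (h1 : (M.seifertSplice O S hS).OneComponent) (hd : M.AtDoublePoint d) (hdS : M.vertex d ∉ S)
    (hf : (M.seifertSplice O S hS).facePerm.SameCycle d (M.rot (M.rot d))) :
    (M.seifertSplice O S hS).IsReducibleKnotProjection := by
  have hd' := (seifertSplice_atDoublePoint O hS d).2 ⟨hd, hdS⟩
  refine ⟨⟨⟨_, d, rfl, hd'⟩, h1, (spherical_seifertSplice_pair O hM hS hSeq hxy hx hy h1).1⟩, ?_⟩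
  refine hasNugatoryCrossing_of_face_eq hd' (face_eq_of_sameCycle ?_)
  rwa [seifertSplice_rot_rot_of_notMem O hS hdS]

/-- At least two Seifert splices are needed to turn a reduced knot projection into a reducible one. -/
theorem IsReducedKnotProjection.two_le_encard (hM : M.IsReducedKnotProjection)
    {S : Set M.Vertex} (hS : S ⊆ M.doublePoints)
    (h : (M.seifertSplice O S hS).IsReducibleKnotProjection) : 2 ≤ S.encard := by
  by_contra! hlt
  have h1 : S.encard ≤ 1 := by
    have : S.encard < 1 + 1 := by rwa [one_add_one_eq_two]
    exact Order.le_of_lt_add_one this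
  rcases Set.encard_le_one_iff_eq.1 h1 with rfl | ⟨v, rfl⟩
  · rw [seifertSplice_empty] at h
    exact hM.2 h.2
  · exact not_oneComponent_seifertSplice_singleton O hM.1.oneComponent hS h.1.oneComponent

end Reducible

/-! ### From a configuration to two splices -/

namespace Circle

variable {D : Type*} {M : CurveMap D}

section Union

variable {k : ℕ} [NeZero k] {C : M.Circle k} {e : Fin k → Bool}

theorem outEnd_mem_arc_iff {s t : Bool} {i j : Fin k} :
    C.outEnd e s i ∈ C.arc (C.outEnd e t j) ↔ s = t ∧ i = j := by
  constructor
  · intro h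
    exact outEnd_inj (eq_of_mem_arc h (vertex_outEnd_mem s i))
  · rintro ⟨rfl, rfl⟩
    exact C.self_mem_arc _

theorem next_eq_of_mem_arc {s : Bool} {i j : Fin k}
    (h : C.Connects (C.outEnd e s i) (C.inEnd e s j)) {x : D} (hx : x ∈ C.arc (C.outEnd e s i)) :
    (M.next x ∈ C.arc (C.outEnd e s i) ∧ M.vertex (M.next x) ∉ C.points) ∨
      M.next x = C.outEnd e (!s) j := by
  by_cases hp : M.vertex (M.edge x) ∈ C.points
  · right
    rw [next, (connects_of_mem_arc hx hp).unique h, opp_inEnd]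
  · left
    exact ⟨next_mem_arc hx hp, by rwa [vertex_next]⟩

end Union

variable [Finite D]

/-- The points 1 and 2 are spliced, and point 0 becomes nugatory. -/
theorem IsThreePointConfiguration.exists_splice {C : M.Circle 3} (hC : C.IsThreePointConfiguration)
    (hM : M.IsKnotProjection) :
    ∃ (O : M.Orientation) (S : Set M.Vertex) (hS : S ⊆ M.doublePoints),
      S.encard = 2 ∧ (M.seifertSplice O S hS).IsReducibleKnotProjection := by
  obtain ⟨e, he⟩ := hC
  obtain ⟨O, hO⟩ := hM.oneComponent.exists_orientation (C.branchEnd true 0 (e 0))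
  have hopp : ∀ i b, O.out (C.branchEnd false i b) = !O.out (C.branchEnd true i b) := fun i b => by
    rw [← O.out_opp, opp_branchEnd]; rfl
  have hq : ∀ i, O.out (C.branchEnd true (i + 1) (!e (i + 1))) = !O.out (C.branchEnd true i (e i)) :=
    fun i => (he i).1.out_eq O
  have hp : ∀ i, O.out (C.branchEnd true (i + 1) (e (i + 1))) =
      !O.out (C.branchEnd true i (!e i)) := fun i => by
    have := (he i).2.out_eq O
    rw [hopp, hopp] at this
    simpa using this
  -- Because the number of points is odd, alternating between the arcs of the two sides links one
  -- branch end at point 0 to all branches, so one choice of direction determines the others.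
  have q1 : O.out (C.branchEnd true 1 (!e 1)) = false := (hq 0).trans (by rw [hO]; rfl)
  have p2 : O.out (C.branchEnd true 2 (e 2)) = true := (hp 1).trans (by rw [q1]; rfl)
  have q0 : O.out (C.branchEnd true 0 (!e 0)) = false := (hq 2).trans (by rw [p2]; rfl)
  have p1 : O.out (C.branchEnd true 1 (e 1)) = true := (hp 0).trans (by rw [q0]; rfl)
  have q2 : O.out (C.branchEnd true 2 (!e 2)) = false := (hq 1).trans (by rw [p1]; rfl)
  have hpq : ∀ i, O.out (C.branchEnd true i (e i)) = true ∧
      O.out (C.branchEnd true i (!e i)) = false := by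
    intro i
    fin_cases i
    · exact ⟨hO, q0⟩
    · exact ⟨p1, q1⟩
    · exact ⟨p2, q2⟩
  have hco : C.Coherent O e := by
    have ht : ∀ i b, O.out (C.branchEnd true i b) = (b ^^ (e i ^^ true)) := by
      intro i b
      obtain ⟨h1, h2⟩ := hpq i
      cases hei : e i <;> cases b <;> simp_all
    intro s i b
    cases s
    · rw [hopp, ht]; simp
    · exact ht i b
  have hc : ∀ s i, C.Connects (C.outEnd e s i) (C.inEnd e s (i + 1)) := by
    intro s i
    cases s
    · simpa [outEnd, inEnd] using (he i).2
    · simpa [outEnd, inEnd] using (he i).1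
  have hv : ∀ i j, M.vertex (C.dart i) = M.vertex (C.dart j) ↔ i = j := fun i j =>
    C.vertex_injective.eq_iff
  have hS : {M.vertex (C.dart 1), M.vertex (C.dart 2)} ⊆ M.doublePoints := by
    rintro _ (rfl | rfl) <;> exact ⟨_, rfl, C.atDoublePoint _⟩
  have hS0 : M.vertex (C.dart 0) ∉ ({M.vertex (C.dart 1), M.vertex (C.dart 2)} : Set M.Vertex) := by
    simp [hv]
  have hone : (M.seifertSplice O _ hS).OneComponent := by
    refine oneComponent_seifertSplice_pair O hM.oneComponent
      (a := C.outEnd e false 1) (b := C.outEnd e true 1) (c := C.outEnd e true 2)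
      (d := C.outEnd e false 2) hS (by simp [vertex_outEnd]) (hco.out_outEnd _ _)
      (hco.out_outEnd _ _) (by simp [vertex_outEnd]) (hco.out_outEnd _ _)
      (hco.out_outEnd _ _) (by simp [vertex_outEnd]) (by simp [vertex_outEnd, hv])
      -- The part of the curve between its two passages through point 1 runs 1, 2, 0, 1, changing
      -- sides at 2 and 0. It contains just one of the two darts leaving point 2.
      (T := C.arc (C.outEnd e false 1) ∪ C.arc (C.outEnd e true 2) ∪ C.arc (C.outEnd e false 0))
      (by simp [outEnd_mem_arc_iff]) (by simp [outEnd_mem_arc_iff]) ?_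
      (by simp [outEnd_mem_arc_iff]) (by simp [outEnd_mem_arc_iff])
    have hna : ∀ z, M.vertex z ∉ C.points → z ≠ C.outEnd e false 1 := by
      rintro _ hz rfl
      exact hz (vertex_outEnd_mem _ _)
    rintro x ((hx | hx) | hx) -
    · rcases next_eq_of_mem_arc (hc _ _) hx with h | h
      · exact Or.inl ⟨Or.inl (Or.inl h.1), hna _ h.2⟩
      · rw [h]
        exact Or.inl ⟨Or.inl (Or.inr (C.self_mem_arc _)), fun h => by simpa using outEnd_inj h⟩
    · rcases next_eq_of_mem_arc (hc _ _) hx with h | h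
      · exact Or.inl ⟨Or.inl (Or.inr h.1), hna _ h.2⟩
      · rw [h]
        exact Or.inl ⟨Or.inr (C.self_mem_arc _), fun h => by simpa using outEnd_inj h⟩
    · rcases next_eq_of_mem_arc (hc _ _) hx with h | h
      · exact Or.inl ⟨Or.inr h.1, hna _ h.2⟩
      · exact Or.inr h
  refine ⟨O, _, hS, Set.encard_pair (by simp [hv]), ?_⟩
  obtain ⟨-, hup, h1, h2⟩ := spherical_seifertSplice_pair O hM.spherical hS rfl (by simp [hv])
    (hco.out_rot_dart 1) (hco.out_rot_dart 2) hone
  refine isReducible_seifertSplice_pair O hM.spherical hS rfl (by simp [hv])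
    (hco.out_rot_dart 1) (hco.out_rot_dart 2) hone (C.atDoublePoint 0) hS0 ?_
  have g : ∀ i, (M.seifertSplice O _ hS).facePerm.SameCycle (C.dart i)
    (M.rot (M.rot (C.dart (i + 1)))) := fun i => hup _ _ (sameCycle_of_face_eq (C.face_eq i))
  -- The circle leads from one corner at point 0 to the opposite one; the splices merge the regions
  -- on either side of points 1 and 2.
  exact (g 0).trans (h1.symm.trans ((g 1).trans (h2.symm.trans (g 2))))

/-- Splicing point 0 merges the two regions of the circle and so makes point 1 nugatory. A second
splice at a point interlaced with point 0 restores a single component. -/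
theorem IsTwoPointConfiguration.exists_splice {C : M.Circle 2} (hC : C.IsTwoPointConfiguration)
    (hM : M.IsReducedKnotProjection) :
    ∃ (O : M.Orientation) (S : Set M.Vertex) (hS : S ⊆ M.doublePoints),
      S.encard = 2 ∧ (M.seifertSplice O S hS).IsReducibleKnotProjection := by
  obtain ⟨s, -, hself, -⟩ := hC
  have hcon := hself 0
  have hone := hM.1.oneComponent
  set x₀ := C.branchEnd s 0 false with hx₀
  set y₀ := C.branchEnd s 0 true with hy₀
  obtain ⟨O, hO⟩ := hone.exists_orientation x₀
  have hOy : O.out y₀ = false := by rw [hcon.out_eq O, hO]; rfl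
  have hxv : M.vertex x₀ = M.vertex (C.dart 0) := C.vertex_branchEnd ..
  have hyv : M.vertex y₀ = M.vertex (C.dart 0) := C.vertex_branchEnd ..
  set A : Set D := {x | x ∈ C.arc x₀ ∨ M.edge x ∈ C.arc x₀} with hAdef
  have hAedge : ∀ x ∈ A, M.edge x ∈ A := by
    rintro x (h | h)
    · exact Or.inr (by rwa [M.edge_edge])
    · exact Or.inl h
  have hApts : ∀ x ∈ A, M.vertex x ∈ C.points → x = x₀ ∨ x = y₀ := by
    rintro x (h | h) hx
    · exact Or.inl (eq_of_mem_arc h hx)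
    · have := connects_of_mem_arc h (by rwa [M.edge_edge])
      rw [M.edge_edge] at this
      exact Or.inr (this.unique hcon)
  have hx₀A : x₀ ∈ A := Or.inl (C.self_mem_arc _)
  have hy₀A : y₀ ∈ A := by
    obtain ⟨z, hz, hzy⟩ := hcon.exists_mem_arc
    rw [← hzy]
    exact hAedge _ (Or.inl hz)
  have hAout : ∀ x ∈ A, O.out x = true → x ∈ C.arc x₀ := by
    rintro x (h | h) hx
    · exact h
    · have := out_of_mem_arc O h
      rw [O.out_edge, hx, hO] at this
      simp at this
  have hAopp : ∀ x, M.vertex x ∉ C.points → x ∈ A → M.opp x ∈ A := by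
    rintro x hx (h | h)
    · rcases eq_or_exists_of_mem_arc h with rfl | ⟨-, w, hw, rfl⟩
      · exact absurd (C.vertex_branchEnd_mem ..) hx
      · rw [next, opp_opp]
        exact hAedge _ (Or.inl hw)
    · have := next_mem_arc h (by rwa [M.edge_edge])
      rw [next, M.edge_edge] at this
      exact Or.inl this
  -- The loop `A` at point 0 must cross the rest of the curve: otherwise `face_eq_of_closed` would
  -- make point 0 nugatory.
  obtain ⟨x, hxA, hxne, hxrot⟩ : ∃ x ∈ A, M.vertex x ≠ M.vertex (C.dart 0) ∧ M.rot x ∉ A := by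
    by_contra! hrot
    have hbd : ∀ t b, C.branchEnd t 0 b ∈ A → t = s := by
      intro t b h
      rcases hApts _ h (C.vertex_branchEnd_mem ..) with h | h
      · exact (C.branchEnd_inj h).1
      · exact (C.branchEnd_inj h).1
    apply hM.2
    cases s
    · refine hasNugatoryCrossing_of_face_eq (d := M.rot (M.rot (C.dart 0))) ?_
        (face_eq_of_closed (A := A) hAedge (by simpa [vertex_rot] using hrot) ?_ ?_ ?_ ?_)
      · rw [atDoublePoint_rot, atDoublePoint_rot]
        exact C.atDoublePoint 0
      · exact fun h => by simpa using hbd true true h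
      · exact hx₀A
      · rw [M.rot_four]
        exact hy₀A
      · rw [M.rot_four]
        exact fun h => by simpa using hbd true false h
    · refine hasNugatoryCrossing_of_face_eq (C.atDoublePoint 0)
        (face_eq_of_closed (A := A) hAedge hrot ?_ hx₀A hy₀A ?_)
      · exact fun h => by simpa using hbd false true h
      · exact fun h => by simpa using hbd false false h
  have hxpts : M.vertex x ∉ C.points := fun h => by
    rcases hApts x hxA h with rfl | rfl
    · exact hxne hxv
    · exact hxne hyv
  have hxd : M.AtDoublePoint x := by
    by_contra h
    have := hAopp x hxpts hxA
    rw [M.opp_of_not_atDoublePoint h] at this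
    exact hxrot this
  have hpick : ∀ z, ∃ w, O.out w = true ∧ (w = z ∨ w = M.opp z) := by
    intro z
    cases h : O.out z
    · exact ⟨_, by rw [O.out_opp, h]; rfl, Or.inr rfl⟩
    · exact ⟨_, h, Or.inl rfl⟩
  obtain ⟨c, hc, hcx⟩ := hpick x
  obtain ⟨d, hd, hdx⟩ := hpick (M.rot x)
  have hvc : M.vertex c = M.vertex x := by
    rcases hcx with rfl | rfl
    · rfl
    · exact M.vertex_opp x
  have hvd : M.vertex d = M.vertex x := by
    rcases hdx with rfl | rfl
    · exact M.vertex_rot x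
    · rw [vertex_opp, vertex_rot]
  have hcA : c ∈ A := by
    rcases hcx with rfl | rfl
    · exact hxA
    · exact hAopp x hxpts hxA
  have hdA : d ∉ A := by
    rcases hdx with rfl | rfl
    · exact hxrot
    · intro h
      have := hAopp _ (by rwa [vertex_opp, vertex_rot]) h
      rw [opp_opp] at this
      exact hxrot this
  obtain ⟨m, hmx, hm⟩ := exists_coherent O hxd
  -- The loop leaves and returns on the same side of the circle, so the two branches cross the
  -- circle in opposite directions.
  have h0 : O.out (M.rot (C.dart 0)) = O.out (C.dart 0) := by
    have h2 := O.out_rot_rot (C.atDoublePoint 0)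
    have h3 := O.out_rot_rot_rot (C.atDoublePoint 0)
    cases s
    · have e1 : O.out (M.rot (M.rot (M.rot (C.dart 0)))) = true := hO
      have e2 : O.out (C.dart 0) = false := hOy
      rw [e1] at h3
      rw [e2]
      simpa using h3.symm
    · have e1 : O.out (M.rot (C.dart 0)) = true := hO
      have e2 : O.out (M.rot (M.rot (C.dart 0))) = false := hOy
      rw [e2] at h2
      rw [e1]
      simpa using h2
  have hS : {M.vertex (C.dart 0), M.vertex m} ⊆ M.doublePoints := by
    rintro _ (rfl | rfl)
    · exact ⟨_, rfl, C.atDoublePoint 0⟩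
    · exact ⟨x, hmx.symm, hxd⟩
  have hne : M.vertex m ≠ M.vertex (C.dart 0) := by rwa [hmx]
  have hS1 : M.vertex (C.dart 1) ∉ ({M.vertex (C.dart 0), M.vertex m} : Set M.Vertex) := by
    rintro (h | h)
    · simpa using C.vertex_injective h
    · exact hxpts ⟨1, h.trans hmx⟩
  have hsp : (M.seifertSplice O _ hS).OneComponent := by
    refine oneComponent_seifertSplice_pair O hone (a := x₀) (b := M.opp y₀) (c := c) (d := d) hS
      (by rw [hxv, hvc, hmx]) hO (by rw [O.out_opp, hOy]; rfl) (by rw [vertex_opp, hxv, hyv])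
      hc hd (hvd.trans hvc.symm) (by rw [hvc, hxv]; exact hxne) (T := C.arc x₀) (C.self_mem_arc _)
      ?_ ?_ (hAout c hcA hc) (fun h => hdA (Or.inl h))
    · intro h
      have := eq_of_mem_arc h (by rw [vertex_opp]; exact C.vertex_branchEnd_mem ..)
      rw [hy₀, opp_branchEnd] at this
      simpa using (C.branchEnd_inj this).2.2
    · intro z hz _
      by_cases hp : M.vertex (M.edge z) ∈ C.points
      · right
        rw [next, (connects_of_mem_arc hz hp).unique hcon]
      · left
        refine ⟨next_mem_arc hz hp, ?_⟩
        rintro (h : M.next z = x₀)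
        rw [← vertex_next, h] at hp
        exact hp (C.vertex_branchEnd_mem ..)
  refine ⟨O, _, hS, Set.encard_pair hne.symm, ?_⟩
  obtain ⟨-, hup, h1, -⟩ := spherical_seifertSplice_pair O hM.1.spherical hS rfl hne h0 hm hsp
  refine isReducible_seifertSplice_pair O hM.1.spherical hS rfl hne h0 hm hsp (C.atDoublePoint 1)
    hS1 ?_
  have g : ∀ i, (M.seifertSplice O _ hS).facePerm.SameCycle (C.dart i)
    (M.rot (M.rot (C.dart (i + 1)))) := fun i => hup _ _ (sameCycle_of_face_eq (C.face_eq i))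
  exact (g 1).trans (h1.symm.trans (g 0))

end Circle

/-! ### Circles obtained from merged regions -/

section MergedRegions

variable {D : Type*} {M : CurveMap D}

/-- The circle through two double points that runs through the two given regions. -/
theorem exists_circle_two {d e : D} (hd : M.AtDoublePoint d) (he : M.AtDoublePoint e)
    (hv : M.vertex d ≠ M.vertex e) (h1 : M.face d = M.face (M.rot (M.rot e)))
    (h2 : M.face e = M.face (M.rot (M.rot d))) (h3 : M.face d ≠ M.face e) :
    ∃ C : M.Circle 2, C.dart 0 = d ∧ C.dart 1 = e :=
  ⟨{ dart := ![d, e]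
     atDoublePoint := by simp [Fin.forall_fin_two, hd, he]
     vertex_injective := by
       intro i j
       fin_cases i <;> fin_cases j <;> simp [hv, hv.symm]
     face_eq := by simp [Fin.forall_fin_two, h1, h2]
     face_injective := by
       intro i j
       fin_cases i <;> fin_cases j <;> simp [h3, h3.symm] }, rfl, rfl⟩

theorem exists_circle_three {d e f : D} (hd : M.AtDoublePoint d) (he : M.AtDoublePoint e)
    (hf : M.AtDoublePoint f) (hde : M.vertex d ≠ M.vertex e) (hdf : M.vertex d ≠ M.vertex f)
    (hef : M.vertex e ≠ M.vertex f) (h1 : M.face d = M.face (M.rot (M.rot e)))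
    (h2 : M.face e = M.face (M.rot (M.rot f))) (h3 : M.face f = M.face (M.rot (M.rot d)))
    (gde : M.face d ≠ M.face e) (gdf : M.face d ≠ M.face f) (gef : M.face e ≠ M.face f) :
    ∃ C : M.Circle 3, C.dart 0 = d ∧ C.dart 1 = e ∧ C.dart 2 = f :=
  ⟨{ dart := ![d, e, f]
     atDoublePoint := by
       intro i
       fin_cases i <;> simp [hd, he, hf]
     vertex_injective := by
       intro i j
       fin_cases i <;> fin_cases j <;> simp [hde, hdf, hef, hde.symm, hdf.symm, hef.symm]
     face_eq := by
       intro i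
       fin_cases i <;> simp [h1, h2, h3]
     face_injective := by
       intro i j
       fin_cases i <;> fin_cases j <;> simp [gde, gdf, gef, gde.symm, gdf.symm, gef.symm] },
    rfl, rfl, rfl⟩

variable [Finite D] (O : M.Orientation)

/-- Two regions that become one by two Seifert splices are joined by a chain of regions through one or
both of the spliced double points. -/
theorem exists_chain_of_merged {x y d d' : D} {S : Set M.Vertex} (hS : S ⊆ M.doublePoints)
    (hSeq : S = {M.vertex x, M.vertex y}) (hxy : M.vertex y ≠ M.vertex x)
    (hx : O.out (M.rot x) = O.out x) (hy : O.out (M.rot y) = O.out y)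
    (h : (M.seifertSplice O S hS).facePerm.SameCycle d d') (hne : M.face d ≠ M.face d') :
    (∃ z e, (z = x ∨ z = y) ∧ (e = z ∨ e = M.rot (M.rot z)) ∧
      M.face d = M.face (M.rot (M.rot e)) ∧ M.face e = M.face d') ∨
    ∃ z w e f, (z = x ∧ w = y ∨ z = y ∧ w = x) ∧ (e = z ∨ e = M.rot (M.rot z)) ∧
      (f = w ∨ f = M.rot (M.rot w)) ∧ M.face d = M.face (M.rot (M.rot e)) ∧
      M.face e = M.face (M.rot (M.rot f)) ∧ M.face f = M.face d' := by
  classical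
  subst hSeq
  have hdx : M.AtDoublePoint x := (M.vertex_mem_doublePoints x).1 (hS (by simp))
  have hdy : M.AtDoublePoint y := (M.vertex_mem_doublePoints y).1 (hS (by simp))
  have hS1 : {M.vertex x} ⊆ M.doublePoints := fun v hv => hS (Or.inl hv)
  have f1 := seifertSplice_facePerm_insert O (Set.empty_subset _) hS1 hdx hx (Set.notMem_empty _)
    (by simp)
  have f2 := seifertSplice_facePerm_insert O hS1 hS hdy hy (by simpa using hxy)
    (by rw [Set.pair_comm])
  rw [seifertSplice_empty] at f1
  rw [f1] at f2
  have rx := M.rot_four x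
  have ry := M.rot_four y
  set A := M.face x with hA
  set A' := M.face (M.rot (M.rot x)) with hA'
  set B := M.face y with hB
  set B' := M.face (M.rot (M.rot y)) with hB'
  set F := M.face d with hF
  -- `r G` says that `G` is reached from `F` using each of the links `A`, `A'` and `B`, `B'` at most
  -- once, in either order and direction. It is invariant under both links, hence constant on the
  -- regions of the spliced curve.
  let r : M.Face → Prop := fun G => G = F ∨ F = A ∧ G = A' ∨ F = A' ∧ G = A ∨ F = B ∧ G = B' ∨
    F = B' ∧ G = B ∨ F = A ∧ A' = B ∧ G = B' ∨ F = A ∧ A' = B' ∧ G = B ∨ F = A' ∧ A = B ∧ G = B' ∨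
    F = A' ∧ A = B' ∧ G = B ∨ F = B ∧ B' = A ∧ G = A' ∨ F = B ∧ B' = A' ∧ G = A ∨
    F = B' ∧ B = A ∧ G = A' ∨ F = B' ∧ B = A' ∧ G = A
  have r1 : r A = r A' := by
    apply propext
    simp only [r]
    clear_value A A' B B' F
    grind
  have r2 : r B = r B' := by
    apply propext
    simp only [r]
    clear_value A A' B B' F
    grind
  have hr := eq_of_sameCycle (u := fun z => r (M.face z)) (by
    rw [f2]
    refine swap_mul_invariant (u := fun z => r (M.face z))
      (swap_mul_invariant (u := fun z => r (M.face z)) ?_ r1) r2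
    exact fun z => congrArg r (face_eq_of_sameCycle (sameCycle_apply_left.2 (SameCycle.refl _ z)))) h
  have hr' : r (M.face d') := by
    rw [← hr]
    exact Or.inl rfl
  rcases hr' with h | ⟨h1, h2⟩ | ⟨h1, h2⟩ | ⟨h1, h2⟩ | ⟨h1, h2⟩ | ⟨h1, h2, h3⟩ | ⟨h1, h2, h3⟩ |
    ⟨h1, h2, h3⟩ | ⟨h1, h2, h3⟩ | ⟨h1, h2, h3⟩ | ⟨h1, h2, h3⟩ | ⟨h1, h2, h3⟩ | ⟨h1, h2, h3⟩
  · exact absurd h.symm hne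
  · exact Or.inl ⟨x, _, Or.inl rfl, Or.inr rfl, by rw [rx, h1], h2.symm⟩
  · exact Or.inl ⟨x, _, Or.inl rfl, Or.inl rfl, h1, h2.symm⟩
  · exact Or.inl ⟨y, _, Or.inr rfl, Or.inr rfl, by rw [ry, h1], h2.symm⟩
  · exact Or.inl ⟨y, _, Or.inr rfl, Or.inl rfl, h1, h2.symm⟩
  · exact Or.inr ⟨x, y, _, _, Or.inl ⟨rfl, rfl⟩, Or.inr rfl, Or.inr rfl, by rw [rx, h1],
      by rw [ry, ← hA', h2], h3.symm⟩
  · exact Or.inr ⟨x, y, _, _, Or.inl ⟨rfl, rfl⟩, Or.inr rfl, Or.inl rfl, by rw [rx, h1],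
      by rw [← hA', h2], h3.symm⟩
  · exact Or.inr ⟨x, y, _, _, Or.inl ⟨rfl, rfl⟩, Or.inl rfl, Or.inr rfl, h1,
      by rw [ry, ← hA, h2], h3.symm⟩
  · exact Or.inr ⟨x, y, _, _, Or.inl ⟨rfl, rfl⟩, Or.inl rfl, Or.inl rfl, h1, h2, h3.symm⟩
  · exact Or.inr ⟨y, x, _, _, Or.inr ⟨rfl, rfl⟩, Or.inr rfl, Or.inr rfl, by rw [ry, h1],
      by rw [rx, ← hB', h2], h3.symm⟩
  · exact Or.inr ⟨y, x, _, _, Or.inr ⟨rfl, rfl⟩, Or.inr rfl, Or.inl rfl, by rw [ry, h1],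
      by rw [← hB', h2], h3.symm⟩
  · exact Or.inr ⟨y, x, _, _, Or.inr ⟨rfl, rfl⟩, Or.inl rfl, Or.inr rfl, h1,
      by rw [rx, ← hB, h2], h3.symm⟩
  · exact Or.inr ⟨y, x, _, _, Or.inr ⟨rfl, rfl⟩, Or.inl rfl, Or.inl rfl, h1, h2, h3.symm⟩

end MergedRegions

/-! ### From two splices to a configuration -/

namespace Circle

variable {D : Type*} [Finite D] {M : CurveMap D}

/-- A point where the branches cross in opposite directions contributes zero to the balance
`sum_sign_eq_zero`, so the contribution of point 0 vanishes as well. -/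
theorem exists_coherent_of_ne_zero {k : ℕ} [NeZero k] (C : M.Circle k) (hM : M.IsKnotProjection)
    (O : M.Orientation) (h : ∀ i ≠ 0, O.out (M.rot (C.dart i)) = O.out (C.dart i)) :
    ∃ e, C.Coherent O e := by
  refine ⟨_, coherent_iff.2 fun i => ?_⟩
  by_cases hi : i = 0
  · subst hi
    have hsum := C.sum_sign_eq_zero hM.spherical hM.oneComponent O
    rw [Fintype.sum_eq_single 0] at hsum
    · have h2 := O.out_rot_rot (C.atDoublePoint 0)
      cases h3 : O.out (C.dart 0) <;> cases h4 : O.out (M.rot (C.dart 0)) <;>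
        simp [Orientation.sign, h2, h3, h4] at hsum ⊢
    · intro j hj
      have h2 := O.out_rot_rot (C.atDoublePoint j)
      have h3 := h j hj
      cases h4 : O.out (C.dart j) <;> simp [Orientation.sign, h2, h3, h4]
  · exact h i hi

/-- If both permutations were the identity or both the transposition, alternating between them would
miss some point on some side. -/
theorem exists_self_and_cross (π : Bool → Fin 2 → Fin 2) (hinj : ∀ s, Function.Injective (π s))
    (htr : ∀ Y : Bool → Fin 2 → Prop, (∀ s i, Y s i → Y (!s) (π s i)) → (∃ s i, Y s i) →
        ∀ s i, Y s i) : ∃ s, (∀ i, π s i = i) ∧ ∀ i, π (!s) i = i + 1 := by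
  have h2 : ∀ f : Fin 2 → Fin 2, Function.Injective f → (∀ i, f i = i) ∨ ∀ i, f i = i + 1 := by
    decide
  rcases h2 _ (hinj true) with ht | ht <;> rcases h2 _ (hinj false) with hf | hf
  · have := htr (fun _ i => i = 0) (by rintro (_ | _) i rfl <;> simp [ht, hf]) ⟨true, 0, rfl⟩ true 1
    simp at this
  · exact ⟨true, ht, hf⟩
  · exact ⟨false, hf, ht⟩
  · have := htr (fun s i => s = true ∧ i = 0 ∨ s = false ∧ i = 1)
      (by rintro s i (⟨rfl, rfl⟩ | ⟨rfl, rfl⟩) <;> simp [ht, hf]) ⟨true, 0, by simp⟩ true 1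
    simp at this

theorem Coherent.isTwoPointConfiguration {C : M.Circle 2} {O : M.Orientation} {e : Fin 2 → Bool}
    (h : C.Coherent O e) (hM : M.IsKnotProjection) : C.IsTwoPointConfiguration := by
  obtain ⟨π, hπ, hinj, htr⟩ := h.exists_arcs hM.spherical hM.oneComponent
  obtain ⟨s, h1, h2⟩ := exists_self_and_cross π hinj htr
  have hsymm : ∀ t i, C.Connects (C.inEnd e t (π t i)) (C.outEnd e t i) := fun t i =>
    (hπ t i).symm (vertex_outEnd_mem _ _)
  -- On the side `!s` the arc from point 0 starts on branch `e 0 ^^ s` and ends at point 1 on branch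
  -- `e 1 ^^ !s`; the exclusive or of these is independent of `s`.
  refine ⟨s, e 0 ^^ e 1 ^^ true, fun i => ?_, fun b => ?_⟩
  · have g1 := hπ s i
    have g2 := hsymm s i
    rw [h1] at g1 g2
    cases hs : s <;> cases hei : e i <;> simp_all [outEnd, inEnd]
  · have g1 := hπ (!s) 0
    have g2 := hsymm (!s) 1
    rw [h2] at g1 g2
    cases s <;> cases he0 : e 0 <;> cases he1 : e 1 <;> cases b <;> simp_all [outEnd, inEnd]

theorem Coherent.isThreePointConfiguration {C : M.Circle 3} {O : M.Orientation} {e : Fin 3 → Bool}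
    (h : C.Coherent O e) (hM : M.IsKnotProjection) {S : Set M.Vertex} (hS : S ⊆ M.doublePoints)
    (hSeq : S = {M.vertex (C.dart 1), M.vertex (C.dart 2)})
    (hone : (M.seifertSplice O S hS).OneComponent) : C.IsThreePointConfiguration := by
  obtain ⟨π, hπ, hinj, htr⟩ := h.exists_arcs hM.spherical hM.oneComponent
  have hmemS : ∀ j, j ≠ 0 → M.vertex (C.dart j) ∈ S := by
    intro j hj
    fin_cases j
    · exact absurd rfl hj
    · simp [hSeq]
    · simp [hSeq]
  have hSpts : S ⊆ C.points := by
    rw [hSeq]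
    rintro _ (rfl | rfl) <;> exact C.vertex_dart_mem _
  -- The spliced curve stays on its side of the circle at points 1 and 2. A family of arcs of one
  -- side avoiding point 0 would therefore be closed, contrary to there being one component; so
  -- every cycle of `π s` contains 0.
  have hzero : ∀ (s : Bool) (Z : Fin 3 → Prop), (∀ i, Z i → Z (π s i)) → (∃ i, Z i) → Z 0 := by
    rintro s Z hZ ⟨i₀, hi₀⟩
    by_contra h0
    have hX : ∀ z ∈ {z : {d // O.out d = true} | ∃ i, Z i ∧ z.1 ∈ C.arc (C.outEnd e s i)},
        (O.splice hS).outNext z ∈ {z | ∃ i, Z i ∧ z.1 ∈ C.arc (C.outEnd e s i)} := by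
      rintro ⟨z, hz⟩ ⟨i, hi, hzi⟩
      have hnz : ((O.splice hS).outNext ⟨z, hz⟩ : D) = (M.seifertSplice O S hS).next z := rfl
      change ∃ j, Z j ∧ ((O.splice hS).outNext ⟨z, hz⟩ : D) ∈ C.arc (C.outEnd e s j)
      rw [hnz]
      by_cases hp : M.vertex (M.edge z) ∈ C.points
      · have he := (connects_of_mem_arc hzi hp).unique (hπ s i)
        have hj : π s i ≠ 0 := fun h => h0 (h ▸ hZ i hi)
        rw [seifertSplice_next_of_mem O hS (by rw [he, vertex_inEnd]; exact hmemS _ hj), he,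
          h.seifertPartner_inEnd]
        exact ⟨_, hZ i hi, C.self_mem_arc _⟩
      · rw [seifertSplice_next_of_notMem O hS fun h => hp (hSpts h)]
        exact ⟨i, hi, next_mem_arc hzi hp⟩
    obtain ⟨i, hi, hmem⟩ := CurveMap.mem_of_sameCycle hX
      ((O.splice hS).oneComponent_iff.1 hone ⟨C.outEnd e s i₀, h.out_outEnd s i₀⟩
        ⟨C.outEnd e s 0, h.out_outEnd s 0⟩) ⟨i₀, hi₀, C.self_mem_arc _⟩
    obtain ⟨-, rfl⟩ := outEnd_mem_arc_iff.1 hmem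
    exact h0 hi
  have h3 : ∀ f : Fin 3 → Fin 3, Function.Injective f → f 1 ≠ 1 → f 2 ≠ 2 → ¬ (f 1 = 2 ∧ f 2 = 1) →
      (∀ i, f i = i + 1) ∨ ∀ i, f (i + 1) = i := by
    decide
  have hπ3 : ∀ s, (∀ i, π s i = i + 1) ∨ ∀ i, π s (i + 1) = i := by
    intro s
    refine h3 _ (hinj s) (fun h => ?_) (fun h => ?_) (fun h => ?_)
    · simpa using hzero s (fun i => i = 1) (by rintro i rfl; exact h) ⟨1, rfl⟩
    · simpa using hzero s (fun i => i = 2) (by rintro i rfl; exact h) ⟨2, rfl⟩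
    · simpa using hzero s (fun i => i = 1 ∨ i = 2)
        (by rintro i (rfl | rfl); exacts [Or.inr h.1, Or.inl h.2]) ⟨1, Or.inl rfl⟩
  -- Inverse 3-cycles on the two sides would bring the curve back to its start after two arcs.
  have hopp : ∀ s, (∀ i, π s i = i + 1) → (∀ i, π (!s) (i + 1) = i) → False := by
    intro s hs hs'
    have := htr (fun t i => t = s ∧ i = 0 ∨ t = (!s) ∧ i = 1)
      (by
        rintro t i (⟨rfl, rfl⟩ | ⟨rfl, rfl⟩)
        · exact Or.inr ⟨rfl, hs 0⟩
        · exact Or.inl ⟨Bool.not_not s, hs' 0⟩) ⟨s, 0, by simp⟩ s 1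
    simp at this
  rcases hπ3 true with ht | ht <;> rcases hπ3 false with hf | hf
  · refine ⟨e, fun i => ⟨?_, ?_⟩⟩
    · simpa [outEnd, inEnd, ht] using hπ true i
    · simpa [outEnd, inEnd, hf] using hπ false i
  · exact (hopp true ht hf).elim
  · exact (hopp false hf ht).elim
  -- Both cycles run against the order of the circle; reversing the orientation of the curve
  -- exchanges the roles of the branches.
  · refine ⟨fun i => !e i, fun i => ⟨?_, ?_⟩⟩
    · simpa [outEnd, inEnd, ht] using (hπ true (i + 1)).symm (vertex_outEnd_mem _ _)
    · simpa [outEnd, inEnd, hf] using (hπ false (i + 1)).symm (vertex_outEnd_mem _ _)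

end Circle

/-! ### The configuration produced by two splices -/

section Main

variable {D : Type*} [Finite D] {M : CurveMap D}

theorem IsReducedKnotProjection.exists_configuration (hM : M.IsReducedKnotProjection)
    (O : M.Orientation) {S : Set M.Vertex} (hS : S ⊆ M.doublePoints) (hcard : S.encard = 2)
    (hred : (M.seifertSplice O S hS).IsReducibleKnotProjection) :
    (∃ C : M.Circle 2, C.IsTwoPointConfiguration) ∨
      ∃ C : M.Circle 3, C.IsThreePointConfiguration := by
  obtain ⟨v, w, hvw, hSeq⟩ := Set.encard_eq_two.1 hcard
  obtain ⟨x', hx', hdx'⟩ := hS (show v ∈ S by simp [hSeq])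
  obtain ⟨y', hy', hdy'⟩ := hS (show w ∈ S by simp [hSeq])
  obtain ⟨x, hxx, hx⟩ := exists_coherent O hdx'
  obtain ⟨y, hyy, hy⟩ := exists_coherent O hdy'
  have hdx := (M.atDoublePoint_congr hxx).2 hdx'
  have hdy := (M.atDoublePoint_congr hyy).2 hdy'
  have hvx : M.vertex x = v := hxx.trans hx'
  have hvy : M.vertex y = w := hyy.trans hy'
  rw [← hvx, ← hvy] at hSeq
  have hxy : M.vertex y ≠ M.vertex x := by
    rw [hvx, hvy]
    exact hvw.symm
  obtain ⟨hproj, ⟨C₁⟩⟩ := hred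
  set d := C₁.dart 0 with hd0
  obtain ⟨hd, hdS⟩ := (seifertSplice_atDoublePoint O hS d).1 (C₁.atDoublePoint 0)
  have hface := sameCycle_of_face_eq (C₁.face_eq 0)
  have hd1 : C₁.dart (0 + 1) = d := rfl
  rw [hd1, ← hd0, seifertSplice_rot_rot_of_notMem O hS hdS] at hface
  have hne : M.face d ≠ M.face (M.rot (M.rot d)) := fun h =>
    hM.2 (hasNugatoryCrossing_of_face_eq hd h)
  have hdouble : ∀ z e, (z = x ∨ z = y) → (e = z ∨ e = M.rot (M.rot z)) →
      M.AtDoublePoint e ∧ M.vertex e = M.vertex z ∧ M.vertex d ≠ M.vertex e ∧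
        O.out (M.rot e) = O.out e := by
    intro z e hz he
    have h1 : M.vertex e = M.vertex z := by
      rcases he with rfl | rfl <;> simp [vertex_rot]
    have h2 : M.AtDoublePoint z := by rcases hz with rfl | rfl <;> assumption
    refine ⟨(M.atDoublePoint_congr h1).2 h2, h1, fun h => hdS ?_, ?_⟩
    · rw [h, h1, hSeq]
      rcases hz with rfl | rfl <;> simp
    · have h3 : O.out (M.rot z) = O.out z := by rcases hz with rfl | rfl <;> assumption
      rcases he with rfl | rfl
      · exact h3
      · rw [O.out_rot_rot_rot h2, O.out_rot_rot h2, h3]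
  have htwo : ∀ z e, (z = x ∨ z = y) → (e = z ∨ e = M.rot (M.rot z)) →
      M.face d = M.face (M.rot (M.rot e)) → M.face e = M.face (M.rot (M.rot d)) →
      ∃ C : M.Circle 2, C.IsTwoPointConfiguration := by
    intro z e hz he h1 h2
    obtain ⟨hde, -, hve, hoe⟩ := hdouble z e hz he
    obtain ⟨C, hC0, hC1⟩ := exists_circle_two hd hde hve h1 h2 (by rw [h2]; exact hne)
    obtain ⟨ε, hε⟩ := C.exists_coherent_of_ne_zero hM.1 O (by
      intro i hi
      obtain rfl : i = 1 := by omega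
      rw [hC1, hoe])
    exact ⟨C, hε.isTwoPointConfiguration hM.1⟩
  rcases exists_chain_of_merged O hS hSeq hxy hx hy hface hne with
    ⟨z, e, hz, he, h1, h2⟩ | ⟨z, w, e, f, hzw, he, hf, h1, h2, h3⟩
  · exact Or.inl (htwo z e hz he h1 h2)
  have hz : z = x ∨ z = y := by tauto
  have hw : w = x ∨ w = y := by tauto
  -- A circle must run through distinct regions; a coincidence among them makes one of the spliced
  -- points superfluous and shortens the chain to two points.
  by_cases g1 : M.face d = M.face e
  · exact Or.inl (htwo w f hw hf (g1.trans h2) h3)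
  by_cases g2 : M.face e = M.face f
  · exact Or.inl (htwo z e hz he h1 (g2.trans h3))
  obtain ⟨hde, hve, hved, hoe⟩ := hdouble z e hz he
  obtain ⟨hdf, hvf, hvfd, hof⟩ := hdouble w f hw hf
  have hSeq' : S = {M.vertex e, M.vertex f} := by
    rw [hSeq, hve, hvf]
    rcases hzw with ⟨rfl, rfl⟩ | ⟨rfl, rfl⟩
    · rfl
    · exact Set.pair_comm _ _
  have hef : M.vertex e ≠ M.vertex f := by
    rw [hve, hvf]
    rcases hzw with ⟨rfl, rfl⟩ | ⟨rfl, rfl⟩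
    · exact hxy.symm
    · exact hxy
  obtain ⟨C, hC0, hC1, hC2⟩ := exists_circle_three hd hde hdf hved hvfd hef h1 h2 h3 g1
    (by rw [h3]; exact hne) g2
  obtain ⟨ε, hε⟩ := C.exists_coherent_of_ne_zero hM.1 O (by
    intro i hi
    obtain rfl | rfl : i = 1 ∨ i = 2 := by omega
    · rw [hC1, hoe]
    · rw [hC2, hof])
  exact Or.inr ⟨C, hε.isThreePointConfiguration hM.1 hS (by rw [hC1, hC2, hSeq'])
    hproj.oneComponent⟩

end Main

end CurveMap

theorem mainTheorem4 {D : Type*} [Finite D] (P : CurveMap D) (hP : P.IsReducedKnotProjection) :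
    P.seifertReductivity = 2 ↔
      (∃ C : P.Circle 2, C.IsTwoPointConfiguration) ∨
        (∃ C : P.Circle 3, C.IsThreePointConfiguration) := by
  constructor
  · intro h
    have hne : {n : ℕ∞ | ∃ (O : P.Orientation) (S : Set P.Vertex) (hS : S ⊆ P.doublePoints),
        S.encard = n ∧ (P.seifertSplice O S hS).IsReducibleKnotProjection}.Nonempty := by
      -- The infimum of the empty set is `⊤`, not 2, so the value 2 is attained.
      by_contra hempty
      rw [Set.not_nonempty_iff_eq_empty] at hempty
      rw [CurveMap.seifertReductivity, hempty, sInf_empty] at h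
      exact absurd h (by decide)
    have hmem := csInf_mem hne
    rw [show sInf _ = (2 : ℕ∞) from h] at hmem
    obtain ⟨O, S, hS, hcard, hred⟩ := hmem
    exact hP.exists_configuration O hS hcard hred
  · intro h
    have hex : ∃ (O : P.Orientation) (S : Set P.Vertex) (hS : S ⊆ P.doublePoints),
        S.encard = 2 ∧ (P.seifertSplice O S hS).IsReducibleKnotProjection := by
      rcases h with ⟨C, hC⟩ | ⟨C, hC⟩
      · exact hC.exists_splice hP
      · exact hC.exists_splice hP.1
    refine le_antisymm (sInf_le hex) (le_sInf ?_)
    rintro n ⟨O, S, hS, rfl, hred⟩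
    exact hP.two_le_encard O hS hred
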